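/- Let $\mathrm{Vir}$ be the Virasoro algebra, i.e. the complex Lie algebra with basis $\{c\}\cup\{d_i : i\in\mathbb{Z}\}$ and relations $[d_i,d_j]=(j-i)d_{i+j}+\delta_{i,-j}\frac{i^3-i}{12}c$ and $[c,d_i]=0$ for $i,j\in\mathbb{Z}$. For $\lambda\in\mathbb{C}^*$, $\alpha\in\mathbb{C}$ and $h\in\mathbb{C}[t]$ let $\Omega(\lambda,\alpha,h)$ be the vector space $\mathbb{C}[t,\partial]$ with the $\mathrm{Vir}$-module structure in which $c$ acts as $0$ and $$d_k(\partial^i f)=\lambda^k(\partial-k)^i\Big(\Big(\partial+k\,h(t)-k(k-1)\alpha\,\frac{h(t)-h(\alpha)}{t-\alpha}\Big)f(t)-k(t-k\alpha)f'(t)\Big)$$ for $k\in\mathbb{Z}$, $i\ge 0$, $f\in\mathbb{C}[t]$. For $\mu\in\mathbb{C}^*$ and $\beta\in\mathbb{C}$ let $\Omega(\mu,\beta)$ be the vector space $\mathbb{C}[\partial]$ with the $\mathrm{Vir}$-module structure in which $c$ acts as $0$ and $$d_k(\partial^i)=\mu^k(\partial-k)^i(\partial-\beta k)$$ for $k\in\mathbb{Z}$,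 $i\ge 0$. **Theorem 3.3.** Let $m,n\ge 1$ be integers, let $\lambda_i,\alpha_i\in\mathbb{C}^*$ and $h_i\in\mathbb{C}[t]$ with $\deg h_i=1$ for $1\le i\le m$, and let $\mu_j,\beta_j\in\mathbb{C}^*$ for $1\le j\le n$. Assume that $\lambda_1,\dots,\lambda_m,\mu_1,\dots,\mu_n$ are pairwise distinct. Let $V$ be an irreducible $\mathrm{Vir}$-module and $K$ a positive integer such that for every integer $k\ge K$ the element $d_k$ acts locally finitely on $V$, i.e. every vector of $V$ lies in a finite-dimensional $d_k$-stable subspace of $V$. Then the tensor product of $\mathrm{Vir}$-modules $$\Big(\bigotimes_{i=1}^m\Omega(\lambda_i,\alpha_i,h_i)\otimes\bigotimes_{j=1}^n\Omega(\mu_j,\beta_j)\Big)\otimes V$$ is an irreducible $\mathrm{Vir}$-module. -/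

import Mathlib

open scoped TensorProduct Polynomial

noncomputable section

attribute [local instance 100] LieRing.ofAssociativeRing

/-! ### The Virasoro algebra -/

/-- The underlying complex vector space of the Virasoro algebra: finitely supported
combinations of the `d i` (first component) plus multiples of the central element
(second component). -/
def Vir : Type := (ℤ →₀ ℂ) × ℂ

namespace Vir

instance : AddCommGroup Vir := inferInstanceAs (AddCommGroup ((ℤ →₀ ℂ) × ℂ))

instance : Module ℂ Vir := inferInstanceAs (Module ℂ ((ℤ →₀ ℂ) × ℂ))

/-- The basis element `d i`. -/
def d (i : ℤ) : Vir := ((Finsupp.single i 1, 0) : (ℤ →₀ ℂ) × ℂ)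

/-- The central basis element `c`. -/
def c : Vir := ((0, 1) : (ℤ →₀ ℂ) × ℂ)

/-- The bilinear map with `(d i, d j) ↦ (j - i) d (i + j)`. -/
def wittBracket : (ℤ →₀ ℂ) →ₗ[ℂ] (ℤ →₀ ℂ) →ₗ[ℂ] (ℤ →₀ ℂ) :=
  Finsupp.linearCombination ℂ fun i : ℤ =>
    Finsupp.linearCombination ℂ fun j : ℤ => Finsupp.single (i + j) ((j : ℂ) - (i : ℂ))

/-- The bilinear form with `(d i, d j) ↦ δ_{i,-j} (i ^ 3 - i) / 12`. -/
def cocycle : (ℤ →₀ ℂ) →ₗ[ℂ] (ℤ →₀ ℂ) →ₗ[ℂ] ℂ :=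
  Finsupp.linearCombination ℂ fun i : ℤ =>
    Finsupp.linearCombination ℂ fun j : ℤ =>
      if i = -j then ((i : ℂ) ^ 3 - (i : ℂ)) / 12 else 0

theorem wittBracket_single (i j : ℤ) (a b : ℂ) :
    wittBracket (Finsupp.single i a) (Finsupp.single j b) =
      Finsupp.single (i + j) (a * b * ((j : ℂ) - (i : ℂ))) := by
  simp only [wittBracket, Finsupp.linearCombination_single, LinearMap.smul_apply,
    Finsupp.smul_single, smul_eq_mul, mul_assoc]

theorem cocycle_single (i j : ℤ) (a b : ℂ) :
    cocycle (Finsupp.single i a) (Finsupp.single j b) =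
      a * b * (if i = -j then ((i : ℂ) ^ 3 - (i : ℂ)) / 12 else 0) := by
  simp only [cocycle, Finsupp.linearCombination_single, LinearMap.smul_apply, smul_eq_mul]
  ring

theorem wittBracket_self (x : ℤ →₀ ℂ) : wittBracket x x = 0 := by
  have skew : ∀ x y, wittBracket x y = -wittBracket y x := by
    intro x y
    induction x using Finsupp.induction_linear with
    | zero => simp
    | add f g hf hg => rw [map_add, LinearMap.add_apply, hf, hg, map_add, neg_add]
    | single i a =>
      induction y using Finsupp.induction_linear with
      | zero => simp
      | add f g hf hg => rw [map_add, hf, hg, map_add, LinearMap.add_apply, neg_add]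
      | single j b =>
        rw [wittBracket_single, wittBracket_single, ← Finsupp.single_neg, add_comm i j]
        congr 1
        ring
  exact self_eq_neg.mp (skew x x)

theorem cocycle_self (x : ℤ →₀ ℂ) : cocycle x x = 0 := by
  have skew : ∀ x y, cocycle x y = -cocycle y x := by
    intro x y
    induction x using Finsupp.induction_linear with
    | zero => simp
    | add f g hf hg => rw [map_add, LinearMap.add_apply, hf, hg, map_add, neg_add]
    | single i a =>
      induction y using Finsupp.induction_linear with
      | zero => simp
      | add f g hf hg => rw [map_add, hf, hg, map_add, LinearMap.add_apply, neg_add]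
      | single j b =>
        rw [cocycle_single, cocycle_single]
        by_cases h : i = -j
        · subst h
          simp only [neg_neg, if_true]
          push_cast
          ring
        · rw [if_neg h, if_neg (by omega)]
          ring
  exact self_eq_neg.mp (skew x x)

theorem wittBracket_jacobi (x y z : ℤ →₀ ℂ) :
    wittBracket x (wittBracket y z) =
      wittBracket (wittBracket x y) z + wittBracket y (wittBracket x z) := by
  induction x using Finsupp.induction_linear with
  | zero => simp
  | add f g hf hg => simp only [map_add, LinearMap.add_apply, hf, hg]; abel
  | single i a =>
    induction y using Finsupp.induction_linear with
    | zero => simp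
    | add f g hf hg => simp only [map_add, LinearMap.add_apply, hf, hg]; abel
    | single j b =>
      induction z using Finsupp.induction_linear with
      | zero => simp
      | add f g hf hg => simp only [map_add, hf, hg]; abel
      | single k e =>
        simp only [wittBracket_single]
        rw [show j + (i + k) = i + (j + k) by ring, show i + j + k = i + (j + k) by ring,
          ← Finsupp.single_add]
        congr 1
        push_cast
        ring

theorem cocycle_jacobi (x y z : ℤ →₀ ℂ) :
    cocycle x (wittBracket y z) =
      cocycle (wittBracket x y) z + cocycle y (wittBracket x z) := by
  induction x using Finsupp.induction_linear with
  | zero => simp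
  | add f g hf hg => simp only [map_add, LinearMap.add_apply, hf, hg]; abel
  | single i a =>
    induction y using Finsupp.induction_linear with
    | zero => simp
    | add f g hf hg => simp only [map_add, LinearMap.add_apply, hf, hg]; abel
    | single j b =>
      induction z using Finsupp.induction_linear with
      | zero => simp
      | add f g hf hg => simp only [map_add, hf, hg]; abel
      | single k e =>
        simp only [wittBracket_single, cocycle_single]
        by_cases h : i + j + k = 0
        · have hk : k = -i - j := by omega
          subst hk
          rw [if_pos (by ring), if_pos (by ring), if_pos (by ring)]
          push_cast
          ring
        · rw [if_neg (by omega), if_neg (by omega), if_neg (by omega)]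
          ring

/-- The Lie bracket: bilinear, with
`[d i, d j] = (j - i) d (i + j) + δ_{i,-j} (i ^ 3 - i) / 12 c` and `c` central. -/
instance : LieRing Vir where
  bracket x y := ((wittBracket x.1 y.1, cocycle x.1 y.1) : (ℤ →₀ ℂ) × ℂ)
  add_lie x y z := Prod.ext
    (show wittBracket (x.1 + y.1) z.1 = wittBracket x.1 z.1 + wittBracket y.1 z.1 by
      rw [map_add, LinearMap.add_apply])
    (show cocycle (x.1 + y.1) z.1 = cocycle x.1 z.1 + cocycle y.1 z.1 by
      rw [map_add, LinearMap.add_apply])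
  lie_add x y z := Prod.ext (map_add (wittBracket x.1) y.1 z.1) (map_add (cocycle x.1) y.1 z.1)
  lie_self x := Prod.ext (wittBracket_self x.1) (cocycle_self x.1)
  leibniz_lie x y z := Prod.ext (wittBracket_jacobi x.1 y.1 z.1) (cocycle_jacobi x.1 y.1 z.1)

instance : LieAlgebra ℂ Vir where
  lie_smul a x y := Prod.ext (map_smul (wittBracket x.1) a y.1) (map_smul (cocycle x.1) a y.1)

theorem lie_d_d (i j : ℤ) :
    ⁅d i, d j⁆ = ((j : ℂ) - (i : ℂ)) • d (i + j) +
      (if i = -j then ((i : ℂ) ^ 3 - (i : ℂ)) / 12 else 0) • c := by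
  refine Prod.ext ?_ ?_
  · change wittBracket (Finsupp.single i 1) (Finsupp.single j 1) =
      ((j : ℂ) - (i : ℂ)) • Finsupp.single (i + j) 1 +
        (if i = -j then ((i : ℂ) ^ 3 - (i : ℂ)) / 12 else 0) • (0 : ℤ →₀ ℂ)
    simp [wittBracket_single]
  · change cocycle (Finsupp.single i 1) (Finsupp.single j 1) =
      ((j : ℂ) - (i : ℂ)) • (0 : ℂ) +
        (if i = -j then ((i : ℂ) ^ 3 - (i : ℂ)) / 12 else 0) • (1 : ℂ)
    simp [cocycle_single]

theorem lie_c (x : Vir) : ⁅c, x⁆ = 0 := by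
  refine Prod.ext ?_ ?_
  · change wittBracket 0 x.1 = 0
    simp
  · change cocycle 0 x.1 = 0
    simp

/-- Operators `D i` with `[D i, D j] = (j - i) D (i + j)` define a representation of the
Virasoro algebra in which `d i` acts as `D i` and `c` acts as zero. -/
def repOfWitt {M : Type*} [AddCommGroup M] [Module ℂ M] (D : ℤ → Module.End ℂ M)
    (hD : ∀ i j : ℤ, D i * D j - D j * D i = ((j : ℂ) - (i : ℂ)) • D (i + j)) :
    Vir →ₗ⁅ℂ⁆ Module.End ℂ M where
  toFun x := Finsupp.linearCombination ℂ D x.1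
  map_add' x y := map_add (Finsupp.linearCombination ℂ D) x.1 y.1
  map_smul' a x := map_smul (Finsupp.linearCombination ℂ D) a x.1
  map_lie' {x y} := by
    change Finsupp.linearCombination ℂ D (wittBracket x.1 y.1) =
      ⁅Finsupp.linearCombination ℂ D x.1, Finsupp.linearCombination ℂ D y.1⁆
    generalize x.1 = u
    generalize y.1 = w
    induction u using Finsupp.induction_linear with
    | zero => simp
    | add f g hf hg => simp only [map_add, LinearMap.add_apply, hf, hg, add_lie]
    | single i a =>
      induction w using Finsupp.induction_linear with
      | zero => simp
      | add f g hf hg => simp only [map_add, hf, hg, lie_add]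
      | single j b =>
        rw [wittBracket_single]
        simp only [Finsupp.linearCombination_single, Ring.lie_def, smul_mul_smul_comm]
        rw [mul_comm b a, ← smul_sub, hD, smul_smul]

theorem repOfWitt_d {M : Type*} [AddCommGroup M] [Module ℂ M] (D : ℤ → Module.End ℂ M)
    (hD : ∀ i j : ℤ, D i * D j - D j * D i = ((j : ℂ) - (i : ℂ)) • D (i + j)) (k : ℤ) :
    repOfWitt D hD (d k) = D k := by
  change Finsupp.linearCombination ℂ D (Finsupp.single k 1) = D k
  simp

theorem repOfWitt_c {M : Type*} [AddCommGroup M] [Module ℂ M] (D : ℤ → Module.End ℂ M)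
    (hD : ∀ i j : ℤ, D i * D j - D j * D i = ((j : ℂ) - (i : ℂ)) • D (i + j)) :
    repOfWitt D hD c = 0 := by
  change Finsupp.linearCombination ℂ D 0 = 0
  simp

/-! ### The modules `Ω(μ, β) = ℂ[∂]` -/

/-- The vector space `ℂ[∂]` underlying `Ω(μ, β)`; the polynomial variable `X` is `∂`. -/
def OmegaOne (_mu : ℂˣ) (_β : ℂ) : Type := ℂ[X]

instance (mu : ℂˣ) (β : ℂ) : AddCommGroup (OmegaOne mu β) := inferInstanceAs (AddCommGroup ℂ[X])

instance (mu : ℂˣ) (β : ℂ) : Module ℂ (OmegaOne mu β) := inferInstanceAs (Module ℂ ℂ[X])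

/-- The operator `∂ ^ n ↦ μ ^ k (∂ - k) ^ n (∂ - β k)` on `ℂ[∂]`. -/
def omegaOneOp (mu : ℂˣ) (β : ℂ) (k : ℤ) : Module.End ℂ ℂ[X] :=
  Polynomial.lsum fun n : ℕ => LinearMap.toSpanSingleton ℂ ℂ[X]
    (((mu : ℂ) ^ k) • ((Polynomial.X - Polynomial.C (k : ℂ)) ^ n *
      (Polynomial.X - Polynomial.C (β * (k : ℂ)))))

theorem omegaOneOp_X_pow (mu : ℂˣ) (β : ℂ) (k : ℤ) (n : ℕ) :
    omegaOneOp mu β k (Polynomial.X ^ n) = ((mu : ℂ) ^ k) •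
      ((Polynomial.X - Polynomial.C (k : ℂ)) ^ n *
        (Polynomial.X - Polynomial.C (β * (k : ℂ)))) := by
  rw [← Polynomial.monomial_one_right_eq_X_pow]
  simp [omegaOneOp, Polynomial.lsum_apply, Polynomial.sum_monomial_index]

theorem omegaOneOp_apply (mu : ℂˣ) (β : ℂ) (k : ℤ) (p : ℂ[X]) :
    omegaOneOp mu β k p = ((mu : ℂ) ^ k) •
      (p.comp (Polynomial.X - Polynomial.C (k : ℂ)) *
        (Polynomial.X - Polynomial.C (β * (k : ℂ)))) := by
  induction p using Polynomial.induction_on' with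
  | add p q hp hq => rw [map_add, hp, hq, Polynomial.add_comp, add_mul, smul_add]
  | monomial n a =>
    rw [← mul_one a, ← smul_eq_mul, ← Polynomial.smul_monomial, map_smul,
      Polynomial.monomial_one_right_eq_X_pow, omegaOneOp_X_pow, Polynomial.smul_comp,
      Polynomial.X_pow_comp, smul_mul_assoc, smul_comm]

theorem omegaOneOp_comm (mu : ℂˣ) (β : ℂ) (i j : ℤ) :
    omegaOneOp mu β i * omegaOneOp mu β j - omegaOneOp mu β j * omegaOneOp mu β i =
      ((j : ℂ) - (i : ℂ)) • omegaOneOp mu β (i + j) := by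
  refine LinearMap.ext fun p => ?_
  have hmu : (mu : ℂ) ≠ 0 := mu.ne_zero
  have e : ∀ a b : ℤ, (p.comp (Polynomial.X - Polynomial.C (a : ℂ))).comp
      (Polynomial.X - Polynomial.C (b : ℂ)) =
      p.comp (Polynomial.X - Polynomial.C ((a : ℂ) + (b : ℂ))) := by
    intro a b
    rw [Polynomial.comp_assoc]
    congr 1
    simp only [Polynomial.sub_comp, Polynomial.X_comp, Polynomial.C_comp, map_add]
    ring
  simp only [LinearMap.sub_apply, Module.End.mul_apply, LinearMap.smul_apply, omegaOneOp_apply,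
    Polynomial.smul_comp, Polynomial.mul_comp, e, Polynomial.sub_comp, Polynomial.X_comp,
    Polynomial.C_comp, zpow_add₀ hmu, Int.cast_add]
  rw [add_comm (j : ℂ) (i : ℂ)]
  simp only [Polynomial.smul_eq_C_mul, map_add, map_sub, map_mul]
  ring

instance (mu : ℂˣ) (β : ℂ) : LieRingModule Vir (OmegaOne mu β) :=
  LieRingModule.compLieHom (OmegaOne mu β)
    (repOfWitt (M := OmegaOne mu β) (omegaOneOp mu β) (omegaOneOp_comm mu β))

instance (mu : ℂˣ) (β : ℂ) : LieModule ℂ Vir (OmegaOne mu β) :=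
  LieModule.compLieHom (OmegaOne mu β)
    (repOfWitt (M := OmegaOne mu β) (omegaOneOp mu β) (omegaOneOp_comm mu β))

theorem omegaOne_d (mu : ℂˣ) (β : ℂ) (k : ℤ) (p : ℂ[X]) :
    ⁅d k, (show OmegaOne mu β from p)⁆ = omegaOneOp mu β k p :=
  LinearMap.congr_fun
    (repOfWitt_d (M := OmegaOne mu β) (omegaOneOp mu β) (omegaOneOp_comm mu β) k) p

theorem omegaOne_c (mu : ℂˣ) (β : ℂ) (p : OmegaOne mu β) : ⁅c, p⁆ = 0 :=
  LinearMap.congr_fun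
    (repOfWitt_c (M := OmegaOne mu β) (omegaOneOp mu β) (omegaOneOp_comm mu β)) p

/-! ### The modules `Ω(λ, α, h) = ℂ[t, ∂]` -/

/-- The vector space `ℂ[t, ∂] = ℂ[t][∂]` underlying `Ω(λ, α, h)`; the outer polynomial
variable is `∂` and the inner one is `t`. -/
def OmegaTwo (_lam : ℂˣ) (_α : ℂ) (_h : ℂ[X]) : Type := ℂ[X][X]

instance (lam : ℂˣ) (α : ℂ) (h : ℂ[X]) : AddCommGroup (OmegaTwo lam α h) :=
  inferInstanceAs (AddCommGroup ℂ[X][X])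

instance (lam : ℂˣ) (α : ℂ) (h : ℂ[X]) : Module ℂ (OmegaTwo lam α h) :=
  inferInstanceAs (Module ℂ ℂ[X][X])

/-- The polynomial `(h(t) - h(α)) / (t - α)`. -/
def diffQuot (α : ℂ) (h : ℂ[X]) : ℂ[X] :=
  (h - Polynomial.C (h.eval α)) /ₘ (Polynomial.X - Polynomial.C α)

theorem diffQuot_spec (α : ℂ) (h : ℂ[X]) :
    (Polynomial.X - Polynomial.C α) * diffQuot α h = h - Polynomial.C (h.eval α) := by
  rw [diffQuot, Polynomial.mul_divByMonic_eq_iff_isRoot]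
  simp

/-- The operator
`f ↦ m h f - m (m - 1) α ((h(t) - h(α)) / (t - α)) f - m (t - m α) f'` on `ℂ[t]`. -/
def omegaTwoAux (α : ℂ) (h : ℂ[X]) (m : ℤ) : Module.End ℂ ℂ[X] where
  toFun f := Polynomial.C (m : ℂ) * h * f
    - Polynomial.C ((m : ℂ) * ((m : ℂ) - 1) * α) * diffQuot α h * f
    - Polynomial.C (m : ℂ) * (Polynomial.X - Polynomial.C ((m : ℂ) * α)) *
      Polynomial.derivative f
  map_add' f g := by
    rw [Polynomial.derivative_add]
    ring
  map_smul' a f := by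
    rw [Polynomial.derivative_smul]
    simp only [Polynomial.smul_eq_C_mul, RingHom.id_apply]
    ring

/-- The linear map
`f ↦ λ ^ m (∂ f + m h f - m (m - 1) α ((h(t) - h(α)) / (t - α)) f - m (t - m α) f')`
from `ℂ[t]` to `ℂ[t, ∂]`. -/
def omegaTwoBase (lam : ℂˣ) (α : ℂ) (h : ℂ[X]) (m : ℤ) : ℂ[X] →ₗ[ℂ] ℂ[X][X] where
  toFun f := ((lam : ℂ) ^ m) •
    (Polynomial.X * Polynomial.C f + Polynomial.C (omegaTwoAux α h m f))
  map_add' f g := by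
    simp only [map_add, mul_add, smul_add]
    abel
  map_smul' a f := by
    simp only [map_smul, RingHom.id_apply, ← Polynomial.smul_C, mul_smul_comm, ← smul_add]
    rw [smul_comm]

/-- The operator `∂ ^ i f ↦ (∂ - m) ^ i · omegaTwoBase f` on `ℂ[t, ∂]`. -/
def omegaTwoOp (lam : ℂˣ) (α : ℂ) (h : ℂ[X]) (m : ℤ) : Module.End ℂ ℂ[X][X] :=
  Polynomial.lsum fun i : ℕ =>
    LinearMap.mulLeft ℂ ((Polynomial.X - Polynomial.C (Polynomial.C (m : ℂ))) ^ i) ∘ₗ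
      omegaTwoBase lam α h m

theorem omegaTwoOp_X_pow_mul_C (lam : ℂˣ) (α : ℂ) (h : ℂ[X]) (m : ℤ) (i : ℕ) (f : ℂ[X]) :
    omegaTwoOp lam α h m (Polynomial.X ^ i * Polynomial.C f) = ((lam : ℂ) ^ m) •
      ((Polynomial.X - Polynomial.C (Polynomial.C (m : ℂ))) ^ i *
        (Polynomial.X * Polynomial.C f +
          Polynomial.C (Polynomial.C (m : ℂ) * h * f
            - Polynomial.C ((m : ℂ) * ((m : ℂ) - 1) * α) * diffQuot α h * f
            - Polynomial.C (m : ℂ) * (Polynomial.X - Polynomial.C ((m : ℂ) * α)) *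
              Polynomial.derivative f))) := by
  rw [mul_comm, Polynomial.C_mul_X_pow_eq_monomial]
  simp only [omegaTwoOp, Polynomial.lsum_apply]
  rw [Polynomial.sum_monomial_index _ _ (by simp)]
  simp only [LinearMap.comp_apply, LinearMap.mulLeft_apply, omegaTwoBase, LinearMap.coe_mk,
    AddHom.coe_mk, mul_smul_comm]
  rfl

theorem omegaTwoOp_map_mul_C (lam : ℂˣ) (α : ℂ) (h : ℂ[X]) (m : ℤ) (p f : ℂ[X]) :
    omegaTwoOp lam α h m (p.map Polynomial.C * Polynomial.C f) = ((lam : ℂ) ^ m) •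
      ((p.map Polynomial.C).comp (Polynomial.X - Polynomial.C (Polynomial.C (m : ℂ))) *
        (Polynomial.X * Polynomial.C f + Polynomial.C (omegaTwoAux α h m f))) := by
  induction p using Polynomial.induction_on' with
  | add p q hp hq =>
    rw [Polynomial.map_add, add_mul, map_add, hp, hq, Polynomial.add_comp, add_mul, smul_add]
  | monomial n a =>
    have e : (Polynomial.monomial n a).map (Polynomial.C : ℂ →+* ℂ[X]) =
        a • (Polynomial.X ^ n : ℂ[X][X]) := by
      rw [Polynomial.map_monomial, ← Polynomial.C_mul_X_pow_eq_monomial]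
      ext k : 1
      simp [Polynomial.coeff_C_mul, Polynomial.smul_eq_C_mul]
    rw [e, smul_mul_assoc, map_smul, omegaTwoOp_X_pow_mul_C, Polynomial.smul_comp,
      Polynomial.X_pow_comp, smul_mul_assoc, smul_comm]
    rfl

theorem omegaTwoAux_comm (α : ℂ) (h : ℂ[X]) (i j : ℤ) (f : ℂ[X]) :
    omegaTwoAux α h i (omegaTwoAux α h j f) - omegaTwoAux α h j (omegaTwoAux α h i f)
      + Polynomial.C (j : ℂ) * omegaTwoAux α h j f - Polynomial.C (i : ℂ) * omegaTwoAux α h i f =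
      Polynomial.C ((j : ℂ) - (i : ℂ)) * omegaTwoAux α h (i + j) f := by
  have hh : h = Polynomial.C (h.eval α) + (Polynomial.X - Polynomial.C α) * diffQuot α h := by
    rw [diffQuot_spec]
    ring
  simp only [omegaTwoAux, LinearMap.coe_mk, AddHom.coe_mk]
  generalize diffQuot α h = q at hh ⊢
  generalize h.eval α = b at hh
  subst hh
  simp only [Polynomial.derivative_mul,
    Polynomial.derivative_C, Polynomial.derivative_X, Polynomial.derivative_one, map_add, map_sub, map_mul, Int.cast_add,
    map_one]
  ring

theorem omegaTwoOp_comm (lam : ℂˣ) (α : ℂ) (h : ℂ[X]) (i j : ℤ) :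
    omegaTwoOp lam α h i * omegaTwoOp lam α h j - omegaTwoOp lam α h j * omegaTwoOp lam α h i =
      ((j : ℂ) - (i : ℂ)) • omegaTwoOp lam α h (i + j) := by
  have hlam : (lam : ℂ) ≠ 0 := lam.ne_zero
  refine LinearMap.ext fun p => ?_
  induction p using Polynomial.induction_on' with
  | add p q hp hq => rw [map_add, map_add, hp, hq]
  | monomial n f =>
    have two : ∀ a b : ℤ, omegaTwoOp lam α h a (omegaTwoOp lam α h b
        (Polynomial.X ^ n * Polynomial.C f)) = ((lam : ℂ) ^ (a + b)) •
        ((Polynomial.X - Polynomial.C (Polynomial.C ((a + b : ℤ) : ℂ))) ^ n *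
          ((Polynomial.X - Polynomial.C (Polynomial.C (a : ℂ))) *
              (Polynomial.X * Polynomial.C f + Polynomial.C (omegaTwoAux α h a f)) +
            (Polynomial.X * Polynomial.C (omegaTwoAux α h b f) +
              Polynomial.C (omegaTwoAux α h a (omegaTwoAux α h b f))))) := by
      intro a b
      have e1 := omegaTwoOp_map_mul_C lam α h a
        ((Polynomial.X - Polynomial.C (b : ℂ)) ^ n * Polynomial.X) f
      have e2 := omegaTwoOp_map_mul_C lam α h a
        ((Polynomial.X - Polynomial.C (b : ℂ)) ^ n) (omegaTwoAux α h b f)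
      have e3 := omegaTwoOp_map_mul_C lam α h b (Polynomial.X ^ n) f
      simp only [Polynomial.map_mul, Polynomial.map_pow, Polynomial.map_sub, Polynomial.map_X,
        Polynomial.map_C, Polynomial.mul_comp, Polynomial.pow_comp, Polynomial.sub_comp,
        Polynomial.X_comp, Polynomial.C_comp] at e1 e2 e3
      rw [e3, map_smul, mul_add, map_add, ← mul_assoc, e1, e2, ← smul_add, smul_smul, add_comm a b,
        zpow_add₀ hlam]
      congr 1
      simp only [Int.cast_add, map_add]
      ring
    have one := omegaTwoOp_map_mul_C lam α h (i + j) (Polynomial.X ^ n) f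
    simp only [Polynomial.map_pow, Polynomial.map_X, Polynomial.X_pow_comp] at one
    have key := congrArg (Polynomial.C : ℂ[X] →+* ℂ[X][X]) (omegaTwoAux_comm α h i j f)
    simp only [map_add, map_sub, map_mul] at key
    rw [← Polynomial.C_mul_X_pow_eq_monomial, mul_comm]
    simp only [LinearMap.sub_apply, Module.End.mul_apply, LinearMap.smul_apply]
    rw [two, two, one, add_comm j i, ← smul_sub, smul_comm]
    congr 1
    have sm : ∀ (a : ℂ) (P : ℂ[X][X]), a • P = Polynomial.C (Polynomial.C a) * P := by
      intro a P
      ext k : 1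
      simp [Polynomial.coeff_C_mul, Polynomial.smul_eq_C_mul]
    rw [sm, ← mul_sub]
    simp only [map_sub]
    linear_combination
      (Polynomial.X - Polynomial.C (Polynomial.C ((i + j : ℤ) : ℂ))) ^ n * key

instance (lam : ℂˣ) (α : ℂ) (h : ℂ[X]) : LieRingModule Vir (OmegaTwo lam α h) :=
  LieRingModule.compLieHom (OmegaTwo lam α h)
    (repOfWitt (M := OmegaTwo lam α h) (omegaTwoOp lam α h) (omegaTwoOp_comm lam α h))

instance (lam : ℂˣ) (α : ℂ) (h : ℂ[X]) : LieModule ℂ Vir (OmegaTwo lam α h) :=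
  LieModule.compLieHom (OmegaTwo lam α h)
    (repOfWitt (M := OmegaTwo lam α h) (omegaTwoOp lam α h) (omegaTwoOp_comm lam α h))

theorem omegaTwo_d (lam : ℂˣ) (α : ℂ) (h : ℂ[X]) (m : ℤ) (p : ℂ[X][X]) :
    ⁅d m, (show OmegaTwo lam α h from p)⁆ = omegaTwoOp lam α h m p :=
  LinearMap.congr_fun
    (repOfWitt_d (M := OmegaTwo lam α h) (omegaTwoOp lam α h) (omegaTwoOp_comm lam α h) m) p

theorem omegaTwo_c (lam : ℂˣ) (α : ℂ) (h : ℂ[X]) (p : OmegaTwo lam α h) : ⁅c, p⁆ = 0 :=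
  LinearMap.congr_fun
    (repOfWitt_c (M := OmegaTwo lam α h) (omegaTwoOp lam α h) (omegaTwoOp_comm lam α h)) p

end Vir

/-! ### Finite tensor products of Lie modules -/

namespace PiTensorLie

variable {ι L : Type*} [Fintype ι] [DecidableEq ι] [LieRing L] [LieAlgebra ℂ L]
  {s : ι → Type*} [∀ i, AddCommGroup (s i)] [∀ i, Module ℂ (s i)]
  [∀ i, LieRingModule L (s i)] [∀ i, LieModule ℂ L (s i)]

/-- The action of `x` on a finite tensor product of Lie modules: the sum over `i` of the
operators acting as `x` on the `i`-th factor and as the identity on the other factors. -/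
def act (x : L) : Module.End ℂ (⨂[ℂ] i, s i) :=
  ∑ i, PiTensorProduct.map
    (Function.update (fun _ => LinearMap.id) i (LieModule.toEnd ℂ L (s i) x))

theorem act_tprod (x : L) (v : ∀ i, s i) :
    act x (PiTensorProduct.tprod ℂ v) =
      ∑ i, PiTensorProduct.tprod ℂ (Function.update v i ⁅x, v i⁆) := by
  simp only [act, LinearMap.sum_apply, PiTensorProduct.map_tprod]
  refine Finset.sum_congr rfl fun i _ => congrArg _ (funext fun j => ?_)
  rcases eq_or_ne j i with rfl | hij
  · simp
  · simp [hij]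

theorem act_lie (x y : L) :
    act (s := s) x * act y - act y * act x = act (s := s) ⁅x, y⁆ := by
  ext v
  simp only [LinearMap.compMultilinearMap_apply, LinearMap.sub_apply, Module.End.mul_apply,
    act_tprod, map_sum, ← Finset.sum_sub_distrib]
  have key : ∀ a b : L, ∀ i j : ι, i ≠ j →
      Function.update (Function.update v i ⁅b, v i⁆) j ⁅a, Function.update v i ⁅b, v i⁆ j⁆ =
        Function.update (Function.update v j ⁅a, v j⁆) i
          ⁅b, Function.update v j ⁅a, v j⁆ i⁆ := by
    intro a b i j hij
    rw [Function.update_of_ne hij.symm, Function.update_of_ne hij, Function.update_comm hij]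
  simp only [Finset.sum_sub_distrib]
  rw [Finset.sum_comm (f := fun i j => PiTensorProduct.tprod ℂ
    (Function.update (Function.update v i ⁅x, v i⁆) j ⁅y, Function.update v i ⁅x, v i⁆ j⁆)),
    ← Finset.sum_sub_distrib]
  refine Finset.sum_congr rfl fun i _ => ?_
  rw [← Finset.sum_sub_distrib, Finset.sum_eq_single i]
  · simp only [Function.update_self, Function.update_idem, lie_lie, MultilinearMap.map_update_sub]
  · intro j _ hji
    rw [key x y i j hji.symm, sub_self]
  · simp

instance : LieRingModule L (⨂[ℂ] i, s i) where
  bracket x w := act x w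
  add_lie x y w := by
    change act (x + y) w = act x w + act y w
    rw [← LinearMap.add_apply]
    congr 1
    ext v
    simp only [LinearMap.compMultilinearMap_apply, LinearMap.add_apply, act_tprod, add_lie,
      MultilinearMap.map_update_add, Finset.sum_add_distrib]
  lie_add x := map_add (act x)
  leibniz_lie x y w := by
    change act x (act y w) = act ⁅x, y⁆ w + act y (act x w)
    rw [← act_lie]
    simp

instance : LieModule ℂ L (⨂[ℂ] i, s i) where
  smul_lie a x w := by
    change act (a • x) w = a • act x w
    rw [← LinearMap.smul_apply]
    congr 1
    ext v
    simp only [LinearMap.compMultilinearMap_apply, LinearMap.smul_apply, act_tprod, smul_lie,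
      MultilinearMap.map_update_smul, Finset.smul_sum]
  lie_smul a x w := map_smul (act x) a w

theorem lie_tprod (x : L) (v : ∀ i, s i) :
    ⁅x, PiTensorProduct.tprod ℂ v⁆ =
      ∑ i, PiTensorProduct.tprod ℂ (Function.update v i ⁅x, v i⁆) :=
  act_tprod x v

end PiTensorLie

/-- An element `x` of a complex Lie algebra acts locally finitely on a module `V`: every vector
lies in a finite-dimensional subspace that is stable under `x`. -/
def ActsLocallyFinitely {L : Type*} [LieRing L] (x : L) (V : Type*) [AddCommGroup V]
    [Module ℂ V] [LieRingModule L V] : Prop :=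
  ∀ v : V, ∃ W : Submodule ℂ V, FiniteDimensional ℂ W ∧ v ∈ W ∧ ∀ w ∈ W, ⁅x, w⁆ ∈ W

end

/-! Write `M` for the product of all the factors `Ω`. On each factor, `d k` with `k ≥ 0` acts as `a
^ k`, where `a` is the parameter `λ_i` or `μ_j`, times a polynomial in `k` whose operator
coefficients `D r` do not depend on `k`. On `V`, every vector is killed by `d k` for all large `k`
(`forall_exists_d_eq_zero`). Hence, for `w` in `M ⊗ V` and large `k`, `d k w` is an exponential
polynomial in `k` with vector coefficients and pairwise distinct bases. Such functions are linearly
independent (`ExpPoly.eq_zero_of_sum_eq_zero`), so a submodule containing `w` contains every `D r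
w`, for each `r` and each factor separately (`coeff_mem_of_lie_mem`). This decouples the factors.

In a single factor, the operators `D r` do two things. The coefficient of the top power of `k` reads
off leading coefficients in `∂`, and from it one builds operators that compress a finite-dimensional
space onto the line through `1` without killing it (`omegaOne_contractsTo`, `omegaTwo_contractsTo`);
here `α, β ≠ 0` and `deg h = 1` enter. Conversely, `1` generates the whole factor
(`omegaOne_generates`, `omegaTwo_generates`). By compression, a nonzero submodule `W` contains `1 ⊗
v` for some `v ≠ 0` (`exists_tprod_mem`); by generation it contains `M ⊗ v`. The vectors `v` with `M
⊗ v ⊆ W` form a nonzero submodule of `V`, hence all of `V`.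

For the vanishing on `V`, take an eigenvector `v` of a locally finite `d l`. The vectors `d i v`
with `i > l` span a finite-dimensional space, so some nonzero combination of the `d j` annihilates
both `v` and that space. This gives a linear recurrence which, for large indices, is an invertible
operator applied to `d i v`, so `d i v = 0` (`eventually_eq_zero_of_recurrence`). Vectors
annihilated by all large `d k` form a submodule, and irreducibility finishes. -/

/-! ### Linear independence of exponential polynomials -/

namespace ExpPoly

/-- The shift operator on complex sequences. -/
def shift : Module.End ℂ (ℕ → ℂ) where
  toFun u k := u (k + 1)
  map_add' _ _ := rfl
  map_smul' _ _ := rfl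

/-- The sequence `k ↦ a ^ k p(k)`. -/
def seq (a : ℂ) (p : ℂ[X]) : ℕ → ℂ := fun k => a ^ k * p.eval (k : ℂ)

/-- `shift - a` sends `a ^ k p(k)` to `a ^ k` times `a (p(k + 1) - p(k))`, and differencing lowers
the degree, so iterating reaches zero. -/
theorem seq_mem (a : ℂ) (p : ℂ[X]) : seq a p ∈ shift.maxGenEigenspace a := by
  suffices H : ∀ n : ℕ, ∀ p : ℂ[X], p.degree < n →
      ((shift - algebraMap ℂ (Module.End ℂ (ℕ → ℂ)) a) ^ n) (seq a p) = 0 by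
    rw [Module.End.mem_maxGenEigenspace]
    exact ⟨p.natDegree + 1, H _ p (lt_of_le_of_lt p.degree_le_natDegree (by
      exact_mod_cast Nat.lt_succ_self _))⟩
  intro n
  induction n with
  | zero =>
    intro p hp
    have : p = 0 := by simpa using hp
    subst this
    funext k
    simp [seq]
  | succ n ih =>
    intro p hp
    have step : (shift - algebraMap ℂ (Module.End ℂ (ℕ → ℂ)) a) (seq a p) =
        seq a (Polynomial.C a * (Polynomial.taylor 1 p - p)) := by
      funext k
      simp [seq, shift, Polynomial.taylor_eval, Module.algebraMap_end_apply]
      ring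
    rw [pow_succ, Module.End.mul_apply, step]
    refine ih _ ?_
    have hlt : (Polynomial.taylor 1 p - p).degree < n := by
      rcases eq_or_ne p 0 with rfl | h0
      · simp
      · have h1 : (Polynomial.taylor 1 p - p).degree < (Polynomial.taylor 1 p).degree :=
          Polynomial.degree_sub_lt_left (Polynomial.degree_taylor p 1)
            (by simpa using h0) (Polynomial.leadingCoeff_taylor 1 p)
        rw [Polynomial.degree_taylor] at h1
        rw [Polynomial.degree_eq_natDegree h0] at h1 hp
        refine lt_of_lt_of_le h1 ?_
        have : p.natDegree < n + 1 := by exact_mod_cast hp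
        exact_mod_cast Nat.lt_succ_iff.mp this
    exact lt_of_le_of_lt (by
      rw [← Polynomial.smul_eq_C_mul]; exact Polynomial.degree_smul_le _ _) hlt

/-- Generalized eigenspaces of the shift for distinct eigenvalues are independent, so each summand
vanishes as a sequence; a polynomial vanishing at all natural numbers is zero. -/
theorem eq_zero_of_sum_eq_zero {ι : Type*} [Fintype ι] (a : ι → ℂ) (ha : ∀ i, a i ≠ 0)
    (hinj : Function.Injective a) (p : ι → ℂ[X]) (R : ℕ)
    (hsum : ∀ k : ℕ, R ≤ k → ∑ i, a i ^ k * (p i).eval (k : ℂ) = 0) (i : ι) : p i = 0 := by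
  classical
  -- Translating `k` by `R` makes the relation hold from `0` on; the factor `a i ^ R` is absorbed
  -- into the polynomial.
  let q : ι → ℂ[X] := fun i => Polynomial.C (a i ^ R) * Polynomial.taylor (R : ℂ) (p i)
  have hq : ∑ i, seq (a i) (q i) = 0 := by
    funext k
    have := hsum (k + R) (by omega)
    simp only [Finset.sum_apply, Pi.zero_apply]
    rw [← this]
    refine Finset.sum_congr rfl fun i _ => ?_
    simp [seq, q, Polynomial.taylor_eval]
    ring
  have hind := (Module.End.independent_maxGenEigenspace shift).comp hinj
  have hi : seq (a i) (q i) = 0 := by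
    refine Submodule.disjoint_def.mp (hind i) _ (seq_mem _ _) ?_
    have : seq (a i) (q i) = -∑ j ∈ Finset.univ.erase i, seq (a j) (q j) := by
      rw [eq_neg_iff_add_eq_zero,
        Finset.add_sum_erase _ (fun j => seq (a j) (q j)) (Finset.mem_univ i), hq]
    rw [this]
    refine Submodule.neg_mem _ (Submodule.sum_mem _ fun j hj => ?_)
    exact Submodule.mem_iSup_of_mem j (Submodule.mem_iSup_of_mem (Finset.ne_of_mem_erase hj)
      (seq_mem _ _))
  have hz : q i = 0 := by
    refine Polynomial.eq_zero_of_infinite_isRoot _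
      (Set.Infinite.mono ?_ (Set.infinite_range_of_injective (Nat.cast_injective (R := ℂ))))
    rintro _ ⟨k, rfl⟩
    have := congrFun hi k
    simpa [seq, ha i] using this
  have h2 : a i ^ R ≠ 0 := pow_ne_zero _ (ha i)
  simpa [q, h2, -map_pow] using hz

/-- If a subspace contains the values at all large integers of an exponential polynomial with
vector coefficients, then it contains the coefficients. -/
theorem coeff_mem {ι : Type*} [Fintype ι] {Z : Type*} [AddCommGroup Z] [Module ℂ Z]
    (W : Submodule ℂ Z) (a : ι → ℂ) (ha : ∀ i, a i ≠ 0) (hinj : Function.Injective a)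
    (z : ι → ℕ → Z) (N R : ℕ)
    (hmem : ∀ k : ℕ, R ≤ k →
      ∑ i, (a i ^ k) • ∑ r ∈ Finset.range N, ((k : ℂ) ^ r) • z i r ∈ W)
    (i : ι) (r : ℕ) (hr : r < N) : z i r ∈ W := by
  -- A functional that vanishes on `W` but not on `z i r` reduces the claim to scalar exponential
  -- polynomials.
  by_contra hz
  obtain ⟨f, hf, hW⟩ := Submodule.exists_le_ker_of_notMem hz
  refine hf ?_
  have h0 := eq_zero_of_sum_eq_zero a ha hinj
    (fun i => ∑ r ∈ Finset.range N, Polynomial.monomial r (f (z i r))) R (fun k hk => by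
      have := hW (hmem k hk)
      rw [LinearMap.mem_ker] at this
      rw [← this]
      simp only [map_sum, map_smul, smul_eq_mul, Polynomial.eval_finsetSum,
        Polynomial.eval_monomial]
      refine Finset.sum_congr rfl fun i _ => congrArg _ (Finset.sum_congr rfl fun r _ => ?_)
      ring) i
  have := congrArg (fun p => Polynomial.coeff p r) h0
  simpa [Polynomial.finsetSum_coeff, Polynomial.coeff_monomial, hr] using this

end ExpPoly

/-! ### Operators acting through one tensor factor -/

section Contraction

variable {X Z : Type*} [AddCommGroup X] [Module ℂ X] [AddCommGroup Z] [Module ℂ Z]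

/-- The vector `w` is supported on the subspace `F` of `X`: operators vanishing on `F`
kill `w`. -/
def SupportedOn (T : Module.End ℂ X →ₐ[ℂ] Module.End ℂ Z) (w : Z) (F : Submodule ℂ X) : Prop :=
  ∀ a : Module.End ℂ X, (∀ x ∈ F, a x = 0) → T a w = 0

/-- Every nonzero finite-dimensional subspace can be mapped onto the line through `x₀` by an
operator in `A`. -/
def ContractsTo (A : Subalgebra ℂ (Module.End ℂ X)) (x₀ : X) : Prop :=
  ∀ F : Submodule ℂ X, FiniteDimensional ℂ F → F ≠ ⊥ →
    ∃ a ∈ A, (∀ x ∈ F, a x ∈ Submodule.span ℂ {x₀}) ∧ ∃ x ∈ F, a x ≠ 0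

theorem SupportedOn.congr {T : Module.End ℂ X →ₐ[ℂ] Module.End ℂ Z} {w : Z}
    {F : Submodule ℂ X} (h : SupportedOn T w F) {a b : Module.End ℂ X}
    (hab : ∀ x ∈ F, a x = b x) : T a w = T b w := by
  have := h (a - b) fun x hx => by rw [LinearMap.sub_apply, hab x hx, sub_self]
  rwa [map_sub, LinearMap.sub_apply, sub_eq_zero] at this

theorem SupportedOn.mono {T : Module.End ℂ X →ₐ[ℂ] Module.End ℂ Z} {w : Z}
    {F G : Submodule ℂ X} (h : SupportedOn T w F) (hFG : F ≤ G) : SupportedOn T w G :=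
  fun a ha => h a fun x hx => ha x (hFG hx)

/-- Induction on the dimension of the support `F`. Contract `F` to the line through `x₀` by some
`a`. If `T a w ≠ 0`, then `ε * a` and `a` agree on `F`, so `T ε` fixes `T a w`. Otherwise `w` is
already supported on the smaller space `F ⊓ ker a`. -/
theorem exists_apply_ne_zero_of_contractsTo (T : Module.End ℂ X →ₐ[ℂ] Module.End ℂ Z)
    {A : Subalgebra ℂ (Module.End ℂ X)} {x₀ : X} (hA : ContractsTo A x₀)
    {ε : Module.End ℂ X} (hε : ε x₀ = x₀) {w : Z} (hw : w ≠ 0) (F : Submodule ℂ X)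
    (hF : FiniteDimensional ℂ F) (hsupp : SupportedOn T w F) :
    ∃ a ∈ A, T a w ≠ 0 ∧ T ε (T a w) = T a w := by
  induction hn : Module.finrank ℂ F using Nat.strong_induction_on generalizing F with
  | _ n ih =>
  have hne : F ≠ ⊥ := by
    rintro rfl
    refine hw ?_
    have := hsupp 1 (by simp)
    simpa using this
  obtain ⟨a, ha, hline, x, hx, hax⟩ := hA F hF hne
  by_cases h0 : T a w = 0
  · have hlt : F ⊓ LinearMap.ker a < F :=
      lt_of_le_of_ne inf_le_left fun h => hax (by
        have : x ∈ F ⊓ LinearMap.ker a := by rw [h]; exact hx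
        exact this.2)
    refine ih _ (hn ▸ Submodule.finrank_lt_finrank_of_lt hlt) (F ⊓ LinearMap.ker a)
      inferInstance ?_ rfl
    intro g hg
    -- Since `g` kills `F ⊓ ker a`, it factors on `F` through `a`. The operator `b` need not lie in
    -- `A`, which is why support is tested against all operators.
    obtain ⟨b, hb⟩ : ∃ b : Module.End ℂ X, ∀ y ∈ F, g y = b (a y) := by
      have hker : LinearMap.ker (a.domRestrict F) ≤ LinearMap.ker (g.domRestrict F) := by
        intro y hy
        exact hg _ ⟨y.2, hy⟩
      obtain ⟨b, hb⟩ := LinearMap.exists_extend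
        (((LinearMap.ker (a.domRestrict F)).liftQ (g.domRestrict F) hker) ∘ₗ
          (a.domRestrict F).quotKerEquivRange.symm.toLinearMap)
      refine ⟨b, fun y hy => ?_⟩
      have := LinearMap.congr_fun hb (⟨a y, ⟨⟨y, hy⟩, rfl⟩⟩ : LinearMap.range (a.domRestrict F))
      have e : (a.domRestrict F).quotKerEquivRange.symm
          (⟨a y, ⟨⟨y, hy⟩, rfl⟩⟩ : LinearMap.range (a.domRestrict F)) =
          Submodule.Quotient.mk ⟨y, hy⟩ := by
        rw [LinearEquiv.symm_apply_eq]
        rfl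
      simp only [LinearMap.comp_apply, LinearEquiv.coe_coe, e] at this
      exact this.symm
    have := hsupp.congr (a := g) (b := b * a) hb
    rw [this, map_mul, Module.End.mul_apply, h0, map_zero]
  · refine ⟨a, ha, h0, ?_⟩
    rw [← Module.End.mul_apply, ← map_mul]
    refine hsupp.congr fun y hy => ?_
    obtain ⟨r, hr⟩ := Submodule.mem_span_singleton.mp (hline y hy)
    rw [Module.End.mul_apply, ← hr, map_smul, hε]

end Contraction

/-! ### Locally finite actions of positive elements -/

namespace Vir

open Filter Topology

/-- A family of vectors in a finite-dimensional space which satisfies `D (e i) = (i - l) e (i + l)`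
and a nontrivial recurrence vanishes for large indices. -/
theorem eventually_eq_zero_of_recurrence {N : Type*} [AddCommGroup N] [Module ℂ N]
    [FiniteDimensional ℂ N] (D : Module.End ℂ N) (e : ℕ → N) (l j₀ : ℕ) (hl : 0 < l)
    (hD : ∀ i, l < i → D (e i) = ((i : ℂ) - l) • e (i + l))
    (q : ℕ) (c : ℕ → ℂ) (hc : c 0 ≠ 0)
    (hrec : ∀ k, l < k → ∑ m ∈ Finset.range (q + 1),
      (c m * ((k : ℂ) - (j₀ + m * l : ℕ))) • e (k + j₀ + m * l) = 0) :
    ∃ R, ∀ i, R ≤ i → e i = 0 := by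
  classical
  have hpow : ∀ (m i : ℕ), l < i →
      (D ^ m) (e i) = (∏ s ∈ Finset.range m, ((i : ℂ) + s * l - l)) • e (i + m * l) := by
    intro m i hi
    induction m with
    | zero => simp
    | succ m ih =>
      rw [pow_succ', Module.End.mul_apply, ih, map_smul, hD _ (by omega), smul_smul,
        Finset.prod_range_succ]
      congr 2
      · push_cast; ring
      · ring
  -- Put `k = i - j₀` in the recurrence, write `e (i + m * l)` as a multiple of `(D ^ m) (e i)` by
  -- `hpow`, and divide by the leading factor `c 0 * (i - 2 * j₀)`: the coefficient of `D ^ m` is `ρ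
  -- m i`. It tends to `0` for `m > 0` and is `1` for `m = 0`.
  let ρ : ℕ → ℕ → ℂ := fun m i => c m / c 0 * (1 - (m * l : ℂ) * ((i : ℂ) - 2 * j₀)⁻¹) *
    ∏ s ∈ Finset.range m, ((i : ℂ) - (l - s * l))⁻¹
  have hinv : ∀ A : ℂ, Tendsto (fun i : ℕ => ((i : ℂ) - A)⁻¹) atTop (𝓝 0) := fun A =>
    tendsto_inv₀_cobounded.comp
      ((tendsto_sub_const_cobounded A).comp tendsto_natCast_atTop_cobounded)
  have hρ : ∀ m, Tendsto (ρ m) atTop (𝓝 (if m = 0 then 1 else 0)) := by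
    intro m
    have h1 : Tendsto (fun i : ℕ => ∏ s ∈ Finset.range m, ((i : ℂ) - (l - s * l))⁻¹) atTop
        (𝓝 (∏ s ∈ Finset.range m, 0)) := tendsto_finsetProd _ fun s _ => hinv _
    have h2 := ((((hinv (2 * j₀)).const_mul (m * l : ℂ)).const_sub 1).const_mul (c m / c 0)).mul h1
    convert h2 using 2
    split_ifs with h
    · subst h
      simp [hc]
    · simp [h]
  let b := Module.finBasis ℂ N
  let G : ℕ → Module.End ℂ N := fun i => ∑ m ∈ Finset.range (q + 1), ρ m i • D ^ m
  -- `G i` tends to the identity, so it is injective for large `i`; the recurrence says that it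
  -- kills `e i`.
  have hdet : Tendsto (fun i => (LinearMap.toMatrix b b (G i)).det) atTop (𝓝 1) := by
    have hG : Tendsto (fun i => LinearMap.toMatrix b b (G i)) atTop (𝓝 1) := by
      have : ∀ i, LinearMap.toMatrix b b (G i) =
          ∑ m ∈ Finset.range (q + 1), ρ m i • LinearMap.toMatrix b b (D ^ m) := by
        intro i
        simp only [G, map_sum, map_smul]
      simp only [this]
      have h1 := tendsto_finsetSum (Finset.range (q + 1)) fun m _ =>
        (hρ m).smul_const (LinearMap.toMatrix b b (D ^ m))
      convert h1 using 2
      rw [Finset.sum_eq_single 0]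
      · simp
      · intro m _ hm
        simp [hm]
      · simp
    have hcont : Continuous fun
        A : Matrix (Fin (Module.finrank ℂ N)) (Fin (Module.finrank ℂ N)) ℂ => A.det := continuous_id.matrix_det
    have := (hcont.tendsto 1).comp hG
    rwa [Matrix.det_one] at this
  have hev := hdet.eventually_ne one_ne_zero
  obtain ⟨R, hR⟩ := eventually_atTop.mp hev
  -- This bound gives `i ≠ 2 * j₀`, `i - j₀ > l` and `i > l`, so no denominator in `ρ` vanishes and
  -- `hrec` applies.
  refine ⟨R + 2 * j₀ + l + 1, fun i hi => ?_⟩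
  have hdi := hR i (by omega)
  rw [LinearMap.det_toMatrix] at hdi
  have hinj : Function.Injective (G i) := by
    have := LinearMap.isUnit_iff_isUnit_det (G i) |>.mpr (isUnit_iff_ne_zero.mpr hdi)
    exact ((Module.End.isUnit_iff _).mp this).1
  refine hinj ?_
  rw [map_zero]
  have hk := hrec (i - j₀) (by omega)
  have hne : ((i : ℂ) - 2 * j₀) ≠ 0 := by
    rw [sub_ne_zero]
    exact_mod_cast (by omega : i ≠ 2 * j₀)
  have : G i (e i) = (c 0 * ((i : ℂ) - 2 * j₀))⁻¹ • ∑ m ∈ Finset.range (q + 1),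
      (c m * (((i - j₀ : ℕ) : ℂ) - (j₀ + m * l : ℕ))) • e (i - j₀ + j₀ + m * l) := by
    simp only [G, LinearMap.sum_apply, LinearMap.smul_apply, Finset.smul_sum]
    refine Finset.sum_congr rfl fun m _ => ?_
    rw [hpow m i (by omega), smul_smul, smul_smul, Nat.sub_add_cancel (by omega)]
    congr 1
    have hprod : (∏ s ∈ Finset.range m, ((i : ℂ) - (l - s * l))⁻¹) *
        ∏ s ∈ Finset.range m, ((i : ℂ) + s * l - l) = 1 := by
      rw [← Finset.prod_mul_distrib]
      refine Finset.prod_eq_one fun s _ => ?_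
      rw [show (i : ℂ) + s * l - l = (i : ℂ) - (l - s * l) by ring]
      refine inv_mul_cancel₀ ?_
      rw [show (i : ℂ) - (l - s * l) = ((i - l + s * l : ℕ) : ℂ) by
        rw [Nat.cast_add, Nat.cast_sub (by omega)]; push_cast; ring]
      exact_mod_cast (by omega : i - l + s * l ≠ 0)
    simp only [ρ]
    rw [mul_assoc, hprod, Nat.cast_sub (by omega)]
    push_cast
    field_simp
    ring
  rw [this, hk, smul_zero]

variable {V : Type*} [AddCommGroup V] [Module ℂ V] [LieRingModule Vir V] [LieModule ℂ Vir V]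

theorem lie_d_d_apply {i j : ℤ} (h : i + j ≠ 0) (v : V) :
    ⁅d i, ⁅d j, v⁆⁆ = ⁅d j, ⁅d i, v⁆⁆ + ((j : ℂ) - i) • ⁅d (i + j), v⁆ := by
  rw [leibniz_lie, lie_d_d, if_neg (by omega), zero_smul, add_zero, smul_lie, add_comm]

theorem exists_eigenvector (x : Vir) (hx : ActsLocallyFinitely x V) [Nontrivial V] :
    ∃ (v : V) (κ : ℂ), v ≠ 0 ∧ ⁅x, v⁆ = κ • v := by
  obtain ⟨v, hv⟩ := exists_ne (0 : V)
  obtain ⟨W, hW, hvW, hst⟩ := hx v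
  have : Nontrivial W := ⟨⟨v, hvW⟩, 0, by simpa [Subtype.ext_iff] using hv⟩
  let f : Module.End ℂ W := (LieModule.toEnd ℂ Vir V x).restrict hst
  obtain ⟨κ, hκ⟩ := Module.End.exists_eigenvalue f
  obtain ⟨w, hw⟩ := hκ.exists_hasEigenvector
  refine ⟨w, κ, by simpa using hw.2, ?_⟩
  exact congrArg Subtype.val hw.apply_eq_smul

/-- For an eigenvector `v` of `d l`, the vectors `d i v` with `i > l` span a finite-dimensional
space. -/
theorem finiteDimensional_span_d (l : ℕ) (hl : 0 < l) (hlf : ActsLocallyFinitely (d l) V)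
    (v : V) (κ : ℂ) (hv : ⁅d l, v⁆ = κ • v) :
    ∃ N : Submodule ℂ V, FiniteDimensional ℂ N ∧ (∀ w ∈ N, ⁅d l, w⁆ ∈ N) ∧
      ∀ i : ℕ, l < i → ⁅d i, v⁆ ∈ N := by
  choose W hfd hmem hst using hlf
  -- One summand per residue class modulo `l`. As `v` is an eigenvector, `(d l - κ) (d i v) = (i -
  -- l) d (i + l) v`; with `i > l` one may divide, so each class stays in the `d l`-stable space of
  -- its first member.
  refine ⟨⨆ j : Fin l, W ⁅d ((l + 1 + j : ℕ) : ℤ), v⁆, inferInstance, ?_, ?_⟩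
  · intro w hw
    induction hw using Submodule.iSup_induction' with
    | mem j x hx => exact Submodule.mem_iSup_of_mem j (hst _ x hx)
    | zero => simp
    | add x y _ _ hx hy => rw [lie_add]; exact Submodule.add_mem _ hx hy
  · intro i hi
    suffices H : ∀ (j : Fin l) (m : ℕ), ⁅d ((l + 1 + j + m * l : ℕ) : ℤ), v⁆ ∈
        W ⁅d ((l + 1 + j : ℕ) : ℤ), v⁆ by
      have := Submodule.mem_iSup_of_mem (p := fun j : Fin l => W ⁅d ((l + 1 + j : ℕ) : ℤ), v⁆) _
        (H ⟨(i - (l + 1)) % l, Nat.mod_lt _ hl⟩ ((i - (l + 1)) / l))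
      have e : l + 1 + (i - (l + 1)) % l + (i - (l + 1)) / l * l = i := by
        have := Nat.mod_add_div' (i - (l + 1)) l
        omega
      simpa only [e] using this
    intro j m
    induction m with
    | zero => simpa using hmem _
    | succ m ih =>
      set i : ℕ := l + 1 + j + m * l with hidef
      have hi : l < i := by omega
      have key := lie_d_d_apply (V := V) (i := (l : ℤ)) (j := (i : ℤ)) (by omega) v
      have hne : ((i : ℂ) - l) ≠ 0 := by
        rw [sub_ne_zero]
        exact_mod_cast hi.ne'
      have e : ((l + 1 + j + (m + 1) * l : ℕ) : ℤ) = (l : ℤ) + i := by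
        rw [hidef]; push_cast; ring
      rw [e]
      have : ⁅d ((l : ℤ) + i), v⁆ = ((i : ℂ) - l)⁻¹ • (⁅d l, ⁅d i, v⁆⁆ - κ • ⁅d i, v⁆) := by
        rw [key, hv, lie_smul]
        simp [hne]
      rw [this]
      exact Submodule.smul_mem _ _ (Submodule.sub_mem _ (hst _ _ ih) (Submodule.smul_mem _ _ ih))

/-- For an eigenvector `v` of `d l`, finite-dimensionality of the span of the `d i v` yields an
element `x` killing `v` and every `d n v` with `n > l`. Expanding `[x, d n] v = 0` gives the
recurrence to which `eventually_eq_zero_of_recurrence` applies. -/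
theorem exists_ne_zero_forall_d_eq_zero [Nontrivial V] (l : ℕ) (hl : 0 < l)
    (hlf : ActsLocallyFinitely (d l) V) :
    ∃ v : V, v ≠ 0 ∧ ∃ R : ℕ, ∀ k : ℕ, R ≤ k → ⁅d k, v⁆ = 0 := by
  classical
  obtain ⟨v, κ, hv0, hv⟩ := exists_eigenvector (V := V) (d l) hlf
  obtain ⟨N, hfd, hst, hmem⟩ := finiteDimensional_span_d l hl hlf v κ hv
  refine ⟨v, hv0, ?_⟩
  let N' : Submodule ℂ V := Submodule.span ℂ ((fun i : ℕ => ⁅d i, v⁆) '' {i | l < i})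
  have hN' : N' ≤ N := Submodule.span_le.mpr (by rintro _ ⟨i, hi, rfl⟩; exact hmem i hi)
  have hfd' : FiniteDimensional ℂ N' := Submodule.finiteDimensional_of_le hN'
  obtain ⟨S, hS, hspan⟩ := (Submodule.fg_span_iff_fg_span_finset_subset _).mp
    ((Submodule.fg_iff_finiteDimensional N').mpr hfd')
  have hS' : ∀ s ∈ S, ∃ i : ℕ, l < i ∧ ⁅d i, v⁆ = s := fun s hs => hS hs
  choose! k hk hkS using hS'
  -- Indices in one progression of step `l`, so that the recurrence relates only vectors linked by
  -- powers of `d l - κ`.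
  let j : ℕ → ℕ := fun m => l + 1 + m * l
  -- The components of `Φ m` are `d (j m) v` and `[d (j m), d (k s)] v` for the finitely many
  -- spanning vectors `s = d (k s) v`. A linear relation among the `Φ m` is therefore an `x` that
  -- kills `v` and every `s`; it exists because the target is finite-dimensional.
  let Φ : ℕ → N × (S → N) := fun m =>
    (⟨⁅d (j m), v⁆, hmem _ (by simp only [j]; omega)⟩, fun s => ((k s : ℂ) - j m) •
      ⟨⁅d (k s + j m : ℕ), v⁆, hmem _ (by simp only [j]; omega)⟩)
  have hdep : ¬ LinearIndependent ℂ Φ := by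
    intro h
    have := h.finite
    exact not_finite ℕ
  rw [linearIndependent_iff] at hdep
  push Not at hdep
  obtain ⟨c, hc, hc0⟩ := hdep
  obtain ⟨q, hq⟩ : ∃ q, c.support ⊆ Finset.range (q + 1) :=
    ⟨c.support.sup id, fun m hm => Finset.mem_range_succ_iff.mpr (Finset.le_sup (f := id) hm)⟩
  let x : Vir := ∑ m ∈ Finset.range (q + 1), c m • d (j m)
  rw [Finsupp.linearCombination_apply, Finsupp.sum_of_support_subset _ hq _ (by simp)] at hc
  have hxv : ⁅x, v⁆ = 0 := by
    have := congrArg (fun z => ((z.1 : N) : V)) hc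
    simpa [x, sum_lie, Φ, Prod.fst_sum] using this
  have hxd : ∀ n : ℕ, ⁅x, ⁅d n, v⁆⁆ = ∑ m ∈ Finset.range (q + 1),
      (c m * ((n : ℂ) - j m)) • ⁅d (n + j m : ℕ), v⁆ := by
    intro n
    have h1 : ⁅x, ⁅d n, v⁆⁆ = ⁅d n, ⁅x, v⁆⁆ + ∑ m ∈ Finset.range (q + 1),
        (c m * ((n : ℂ) - j m)) • ⁅d (n + j m : ℕ), v⁆ := by
      simp only [x, sum_lie, lie_sum, ← Finset.sum_add_distrib, smul_lie, lie_smul]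
      refine Finset.sum_congr rfl fun m _ => ?_
      rw [lie_d_d_apply (by simp only [j]; omega), smul_add, smul_smul]
      congr 4
      push_cast
      ring
    rw [h1, hxv, lie_zero, zero_add]
  have hxS : ∀ s ∈ S, ⁅x, s⁆ = 0 := by
    intro s hs
    have := congrArg (fun z => ((z.2 ⟨s, hs⟩ : N) : V)) hc
    have h2 := hxd (k s)
    rw [hkS s hs] at h2
    rw [h2]
    simpa [Φ, Prod.snd_sum, smul_smul] using this
  have hxN : ∀ w ∈ N', ⁅x, w⁆ = 0 := by
    intro w hw
    have hle : N' ≤ LinearMap.ker (LieModule.toEnd ℂ Vir V x) := by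
      rw [show N' = _ from hspan, Submodule.span_le]
      exact hxS
    exact hle hw
  have hrec : ∀ n : ℕ, l < n → ∑ m ∈ Finset.range (q + 1),
      (c m * ((n : ℂ) - j m)) • ⁅d (n + j m : ℕ), v⁆ = 0 := fun n hn => by
    rw [← hxd]
    exact hxN _ (Submodule.subset_span ⟨n, hn, rfl⟩)
  have hex : ∃ m, c m ≠ 0 := by
    by_contra h
    push Not at h
    exact hc0 (Finsupp.ext h)
  -- The recurrence must start at a nonzero coefficient, so it is shifted to begin at the first one.
  let m₀ := Nat.find hex
  let e : ℕ → N := fun i => if h : l < i then ⟨⁅d i, v⁆, hmem i h⟩ else 0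
  have he : ∀ i, l < i → (e i : V) = ⁅d i, v⁆ := fun i h => by simp [e, h]
  obtain ⟨R, hR⟩ := eventually_eq_zero_of_recurrence
    ((LieModule.toEnd ℂ Vir V (d l) - algebraMap ℂ _ κ).restrict (p := N) (q := N) (fun w hw => by
      rw [LinearMap.sub_apply, Module.algebraMap_end_apply]
      exact N.sub_mem (hst w hw) (N.smul_mem _ hw))) e l (j m₀) hl
    (fun i hi => by
      ext
      simp only [LinearMap.coe_restrict_apply, LinearMap.sub_apply, Module.algebraMap_end_apply,
        LieModule.toEnd_apply_apply, Submodule.coe_smul]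
      rw [he i hi, he (i + l) (by omega), lie_d_d_apply (by omega), hv, lie_smul]
      simp [add_comm]) q (fun m => c (m₀ + m)) (Nat.find_spec hex)
    (fun n hn => by
      ext
      have h0 := hrec n hn
      have h1 : ∑ m ∈ Finset.range (m₀ + (q + 1)),
          (c m * ((n : ℂ) - j m)) • ⁅d (n + j m : ℕ), v⁆ = 0 := by
        rw [← h0]
        symm
        refine Finset.sum_subset (Finset.range_mono (by omega)) fun m _ hm => ?_
        rw [Finsupp.notMem_support_iff.mp fun h => hm (hq h), zero_mul, zero_smul]
      rw [Finset.sum_range_add, Finset.sum_eq_zero, zero_add] at h1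
      · rw [Submodule.coe_sum, Submodule.coe_zero, ← h1]
        refine Finset.sum_congr rfl fun m _ => ?_
        have ej : j m₀ + m * l = j (m₀ + m) := by simp only [j]; ring
        rw [Submodule.coe_smul, add_assoc n, ej, he _ (by omega)]
      · intro m hm
        have : c m = 0 := by
          by_contra h
          exact Nat.find_min hex (Finset.mem_range.mp hm) h
        rw [this, zero_mul, zero_smul])
  refine ⟨R + l + 1, fun n hn => ?_⟩
  rw [← he n (by omega), hR n (by omega), Submodule.coe_zero]

/-- The elements `d i` and `c` span the Virasoro algebra. -/
theorem mem_of_d_mem_of_c_mem (P : Submodule ℂ Vir) (hd : ∀ i, d i ∈ P) (hc : c ∈ P)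
    (x : Vir) : x ∈ P := by
  obtain ⟨f, a⟩ := x
  have hf : (show Vir from (f, 0)) ∈ P := by
    induction f using Finsupp.induction_linear with
    | zero => exact P.zero_mem
    | add f g hf hg =>
      convert P.add_mem hf hg using 1
      exact Prod.ext rfl (add_zero (0 : ℂ)).symm
    | single i r =>
      convert P.smul_mem r (hd i) using 1
      refine Prod.ext ?_ ?_
      · change Finsupp.single i r = r • Finsupp.single i 1
        simp
      · change (0 : ℂ) = r • 0
        simp
  have e : (show Vir from (f, a)) = (show Vir from (f, 0)) + a • c := by
    refine Prod.ext ?_ ?_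
    · change f = f + a • 0
      simp
    · change a = 0 + a • 1
      simp
  have := P.add_mem hf (P.smul_mem a hc)
  rwa [← e] at this

/-- The vectors annihilated by all large `d k` form a submodule, since `d k d i u = d i d k u + (i -
k) d (k + i) u`. It is nonzero by `exists_ne_zero_forall_d_eq_zero`. -/
theorem forall_exists_d_eq_zero (hV : LieModule.IsIrreducible ℂ Vir V) (l : ℕ) (hl : 0 < l)
    (hlf : ActsLocallyFinitely (d l) V) (v : V) :
    ∃ R : ℕ, ∀ k : ℕ, R ≤ k → ⁅d k, v⁆ = 0 := by
  have := LieModule.nontrivial_of_isIrreducible ℂ Vir V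
  obtain ⟨v₀, hv₀, hR₀⟩ := exists_ne_zero_forall_d_eq_zero (V := V) l hl hlf
  let U : Submodule ℂ V :=
    { carrier := {v | ∃ R : ℕ, ∀ k : ℕ, R ≤ k → ⁅d k, v⁆ = 0}
      add_mem' := by
        rintro a b ⟨R, hR⟩ ⟨S, hS⟩
        exact ⟨max R S, fun k hk => by
          rw [lie_add, hR k (le_of_max_le_left hk), hS k (le_of_max_le_right hk), add_zero]⟩
      zero_mem' := ⟨0, fun k _ => lie_zero _⟩
      smul_mem' := by
        rintro r a ⟨R, hR⟩
        exact ⟨R, fun k hk => by rw [lie_smul, hR k hk, smul_zero]⟩ }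
  have hd : ∀ (i : ℤ) (u : V), u ∈ U → ⁅d i, u⁆ ∈ U := by
    rintro i u ⟨R, hR⟩
    -- This makes both `k` and `k + i` at least `R`, and `k + i ≠ 0`, so no central term appears.
    refine ⟨R + 2 * i.natAbs + 1, fun k hk => ?_⟩
    obtain ⟨n, hn⟩ : ∃ n : ℕ, (n : ℤ) = k + i := ⟨(k + i).toNat, by omega⟩
    rw [lie_d_d_apply (by omega), hR k (by omega), lie_zero, ← hn, hR n (by omega), smul_zero,
      add_zero]
  have hc : ∀ u : V, u ∈ U → ⁅c, u⁆ ∈ U := by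
    rintro u ⟨R, hR⟩
    refine ⟨R, fun k hk => ?_⟩
    have h1 : ⁅c, d k⁆ = 0 := lie_c _
    rw [leibniz_lie, ← lie_skew, h1, hR k hk]
    simp
  let P : Submodule ℂ Vir :=
    { carrier := {x | ∀ u ∈ U, ⁅x, u⁆ ∈ U}
      add_mem' := fun {a b} ha hb u hu => by rw [add_lie]; exact U.add_mem (ha u hu) (hb u hu)
      zero_mem' := fun u _ => by rw [zero_lie]; exact U.zero_mem
      smul_mem' := fun r a ha u hu => by rw [smul_lie]; exact U.smul_mem r (ha u hu) }
  have hall : ∀ (x : Vir) (u : V), u ∈ U → ⁅x, u⁆ ∈ U :=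
    mem_of_d_mem_of_c_mem P hd hc
  let W : LieSubmodule ℂ Vir V := { U with lie_mem := fun {x u} hu => hall x u hu }
  have hW : W ≠ ⊥ := by
    intro h
    refine hv₀ ?_
    have h1 : v₀ ∈ W := hR₀
    rwa [h, LieSubmodule.mem_bot] at h1
  have : v ∈ W := by
    rw [(IsSimpleOrder.eq_bot_or_eq_top W).resolve_left hW]
    trivial
  exact this

end Vir

/-! ### Polynomial preliminaries -/

namespace Polynomial

/-- Taylor expansion; it turns the shift `∂ ↦ ∂ - k` into a polynomial in `k`. -/
theorem comp_X_sub_C_eq_sum_hasseDeriv {R : Type*} [CommRing R] (p : R[X]) (a : R) (N : ℕ)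
    (hN : p.natDegree < N) :
    p.comp (X - C a) = ∑ r ∈ Finset.range N, C ((-a) ^ r) * hasseDeriv r p := by
  have mono : ∀ (n : ℕ) (b : R), n < N → (monomial n b).comp (X - C a) =
      ∑ r ∈ Finset.range N, C ((-a) ^ r) * hasseDeriv r (monomial n b) := by
    intro n b hn
    rw [monomial_comp, sub_eq_neg_add, add_pow, Finset.mul_sum]
    have h1 : ∑ r ∈ Finset.range (n + 1), C ((-a) ^ r) * hasseDeriv r (monomial n b) =
        ∑ r ∈ Finset.range N, C ((-a) ^ r) * hasseDeriv r (monomial n b) := by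
      refine Finset.sum_subset (Finset.range_mono hn) fun r _ hr => ?_
      rw [hasseDeriv_monomial, Nat.choose_eq_zero_of_lt (by simpa using hr)]
      simp
    rw [← h1]
    refine Finset.sum_congr rfl fun r _ => ?_
    rw [hasseDeriv_monomial, ← C_mul_X_pow_eq_monomial]
    simp only [map_mul, map_pow, map_neg, map_natCast]
    ring
  conv_lhs => rw [p.as_sum_range' N hN]
  conv_rhs => rw [p.as_sum_range' N hN]
  change (compRingHom (X - C a)) _ = _
  simp only [map_sum, Finset.mul_sum]
  rw [Finset.sum_comm (γ := ℕ)]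
  exact Finset.sum_congr rfl fun n hn => mono n _ (Finset.mem_range.mp hn)

theorem hasseDeriv_natDegree_le {R : Type*} [Semiring R] {p : R[X]} {n : ℕ}
    (h : p.natDegree ≤ n) : hasseDeriv n p = C (p.coeff n) := by
  ext i
  rw [hasseDeriv_coeff, coeff_C]
  split_ifs with hi
  · simp [hi]
  · rw [coeff_eq_zero_of_natDegree_lt (by omega), mul_zero]

/-- A nonzero finite-dimensional space of polynomials has an element of maximal degree. -/
theorem exists_max_natDegree {R : Type*} [CommRing R] [Algebra ℂ R] (F : Submodule ℂ R[X])
    (hfd : FiniteDimensional ℂ F) (hF : F ≠ ⊥) :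
    ∃ n, (∀ p ∈ F, p.natDegree ≤ n) ∧ ∃ p ∈ F, p.coeff n ≠ 0 := by
  classical
  obtain ⟨S, hS⟩ := (Submodule.fg_iff_finiteDimensional F).mpr hfd
  have hex : ∃ n, ∀ p ∈ F, p.natDegree ≤ n := by
    refine ⟨S.sup natDegree, ?_⟩
    have hle : F ≤ (degreeLE R (S.sup natDegree : ℕ)).restrictScalars ℂ := by
      rw [← hS, Submodule.span_le]
      intro p hp
      simp only [SetLike.mem_coe, Submodule.restrictScalars_mem, mem_degreeLE]
      exact natDegree_le_iff_degree_le.mp (Finset.le_sup (f := natDegree) hp)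
    intro p hp
    exact natDegree_le_iff_degree_le.mpr (mem_degreeLE.mp (hle hp))
  refine ⟨Nat.find hex, Nat.find_spec hex, ?_⟩
  by_contra! h
  obtain ⟨p, hp, hp0⟩ := Submodule.exists_mem_ne_zero_of_ne_bot hF
  rcases Nat.eq_zero_or_pos (Nat.find hex) with h0 | hpos
  · have h1 := Nat.find_spec hex p hp
    have h2 := h p hp
    rw [h0] at h1 h2
    refine hp0 ?_
    rw [eq_C_of_natDegree_le_zero h1, h2, C_0]
  · refine Nat.find_min hex (Nat.sub_lt hpos one_pos) fun p hp => ?_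
    have h1 := Nat.find_spec hex p hp
    have h2 := h p hp
    rcases h1.lt_or_eq with h3 | h3
    · omega
    · rw [← h3] at h2
      have : p = 0 := leadingCoeff_eq_zero.mp h2
      subst this
      simp

end Polynomial

namespace Vir

/-- On the module `X`, the operators `d k` for `k ≥ 0` are given by the exponential polynomial
`a ^ k ∑ r, k ^ r D r`, the sum being finite on each vector. -/
def HasExpansion (X : Type*) [AddCommGroup X] [Module ℂ X] [LieRingModule Vir X] (a : ℂ)
    (D : ℕ → Module.End ℂ X) : Prop :=
  ∀ x : X, ∃ N, (∀ r, N ≤ r → D r x = 0) ∧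
    ∀ k : ℕ, ⁅d k, x⁆ = (a ^ k) • ∑ r ∈ Finset.range N, ((k : ℂ) ^ r) • D r x

/-- The vector `x₀` generates `X` under the algebra `A` of operators. -/
def Generates {X : Type*} [AddCommGroup X] [Module ℂ X] (A : Subalgebra ℂ (Module.End ℂ X))
    (x₀ : X) : Prop :=
  ∀ x, ∃ b ∈ A, b x₀ = x

theorem generates_of_submodule {X : Type*} [AddCommGroup X] [Module ℂ X]
    {A : Subalgebra ℂ (Module.End ℂ X)} {x₀ : X}
    (h : ∀ P : Submodule ℂ X, (∀ b ∈ A, ∀ x ∈ P, b x ∈ P) → x₀ ∈ P → P = ⊤) :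
    Generates A x₀ := by
  let P : Submodule ℂ X := (Subalgebra.toSubmodule A).map (LinearMap.applyₗ x₀)
  have hP : P = ⊤ := by
    refine h P ?_ ⟨1, A.one_mem, rfl⟩
    rintro b hb _ ⟨c, hc, rfl⟩
    exact ⟨b * c, A.mul_mem hb hc, rfl⟩
  intro x
  have hx : x ∈ P := by rw [hP]; trivial
  obtain ⟨b, hb, rfl⟩ := hx
  exact ⟨b, hb, rfl⟩

/-! ### The coefficient operators of `Ω(μ, β)` -/

section One

open Polynomial

/-- The coefficient of `k ^ r` in the operator `μ ^ (-k) d k` on `Ω(μ, β)`. -/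
noncomputable def omegaOneCoeff (β : ℂ) : ℕ → Module.End ℂ ℂ[X]
  | 0 => LinearMap.mulLeft ℂ X
  | r + 1 => ((-1 : ℂ) ^ (r + 1)) •
      (LinearMap.mulLeft ℂ X ∘ₗ hasseDeriv (r + 1) + β • hasseDeriv r)

theorem omegaOneOp_eq_sum (mu : ℂˣ) (β : ℂ) (k : ℤ) (p : ℂ[X]) (N : ℕ) (hN : p.natDegree < N) :
    omegaOneOp mu β k p = ((mu : ℂ) ^ k) •
      ∑ r ∈ Finset.range (N + 1), ((k : ℂ) ^ r) • omegaOneCoeff β r p := by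
  rw [omegaOneOp_apply]
  congr 1
  have hH : hasseDeriv N p = 0 := hasseDeriv_eq_zero_of_lt_natDegree p N hN
  have h1 : p.comp (X - C (k : ℂ)) * X =
      X * p + ∑ r ∈ Finset.range N, C ((-(k : ℂ)) ^ (r + 1)) * (X * hasseDeriv (r + 1) p) := by
    have : p.comp (X - C (k : ℂ)) =
        ∑ r ∈ Finset.range (N + 1), C ((-(k : ℂ)) ^ r) * hasseDeriv r p :=
      comp_X_sub_C_eq_sum_hasseDeriv p _ _ (by omega)
    rw [this, Finset.sum_range_succ', add_mul, Finset.sum_mul, add_comm]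
    congr 1
    · simp [mul_comm]
    · exact Finset.sum_congr rfl fun r _ => by ring
  rw [mul_sub, h1, comp_X_sub_C_eq_sum_hasseDeriv p _ N hN, Finset.sum_range_succ', Finset.sum_mul,
    add_sub_assoc, ← Finset.sum_sub_distrib, add_comm]
  congr 1
  · refine Finset.sum_congr rfl fun r _ => ?_
    simp only [omegaOneCoeff, LinearMap.smul_apply, LinearMap.add_apply, LinearMap.comp_apply,
      LinearMap.mulLeft_apply, smul_eq_C_mul]
    simp only [map_mul, map_pow, map_neg, map_one, pow_succ, neg_pow (C (k : ℂ))]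
    ring
  · simp [omegaOneCoeff]

theorem omegaOneCoeff_eq_zero (β : ℂ) (p : ℂ[X]) (r : ℕ) (hr : p.natDegree + 1 < r) :
    omegaOneCoeff β r p = 0 := by
  obtain ⟨r, rfl⟩ : ∃ s, r = s + 1 := ⟨r - 1, by omega⟩
  simp [omegaOneCoeff, hasseDeriv_eq_zero_of_lt_natDegree p (r + 1) (by omega),
    hasseDeriv_eq_zero_of_lt_natDegree p r (by omega)]

/-- The Hasse derivative of order `n + 1` vanishes and that of order `n` is the coefficient of `∂ ^
n`. With `n` the maximal degree in a space, this one operator maps the space to constants,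
nontrivially when `β ≠ 0`. -/
theorem omegaOneCoeff_succ_of_natDegree_le (β : ℂ) (p : ℂ[X]) (n : ℕ) (hn : p.natDegree ≤ n) :
    omegaOneCoeff β (n + 1) p = C ((-1) ^ (n + 1) * β * p.coeff n) := by
  simp [omegaOneCoeff, hasseDeriv_eq_zero_of_lt_natDegree p (n + 1) (by omega),
    hasseDeriv_natDegree_le hn, smul_eq_C_mul, mul_assoc]

theorem omegaOne_contractsTo (β : ℂ) (hβ : β ≠ 0) :
    ContractsTo (Algebra.adjoin ℂ (Set.range (omegaOneCoeff β))) (1 : ℂ[X]) := by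
  intro F hfd hF
  obtain ⟨n, hn, p, hp, hpn⟩ := exists_max_natDegree F hfd hF
  refine ⟨omegaOneCoeff β (n + 1), Algebra.subset_adjoin ⟨_, rfl⟩, fun x hx => ?_, p, hp, ?_⟩
  · rw [omegaOneCoeff_succ_of_natDegree_le β x n (hn x hx), Submodule.mem_span_singleton]
    exact ⟨_, by rw [smul_eq_C_mul, mul_one]⟩
  · rw [omegaOneCoeff_succ_of_natDegree_le β p n (hn p hp), Ne, C_eq_zero]
    simp [hβ, hpn]

theorem omegaOne_generates (β : ℂ) :
    Generates (Algebra.adjoin ℂ (Set.range (omegaOneCoeff β))) (1 : ℂ[X]) := by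
  refine generates_of_submodule fun P hP h1 => ?_
  have hX : ∀ p ∈ P, X * p ∈ P := fun p hp =>
    hP (omegaOneCoeff β 0) (Algebra.subset_adjoin ⟨0, rfl⟩) p hp
  refine Submodule.eq_top_iff'.mpr fun p => ?_
  have hpow : ∀ n : ℕ, (X ^ n : ℂ[X]) ∈ P := by
    intro n
    induction n with
    | zero => simpa using h1
    | succ n ih => rw [pow_succ']; exact hX _ ih
  rw [p.as_sum_range_C_mul_X_pow]
  refine P.sum_mem fun n _ => ?_
  rw [← smul_eq_C_mul]
  exact P.smul_mem _ (hpow n)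

theorem omegaOne_hasExpansion (mu : ℂˣ) (β : ℂ) :
    HasExpansion (OmegaOne mu β) mu (omegaOneCoeff β) := by
  intro p
  refine ⟨natDegree (R := ℂ) p + 2, fun r hr => omegaOneCoeff_eq_zero β p r (by omega),
    fun k => ?_⟩
  refine (omegaOne_d mu β k p).trans ?_
  rw [omegaOneOp_eq_sum mu β k p _ (Nat.lt_succ_self _)]
  simp only [zpow_natCast, Int.cast_natCast]
  rfl

end One

/-! ### The coefficient operators of `Ω(λ, α, h)` -/

section Two

open Polynomial

/-- The extension of an operator on `ℂ[t]` to `ℂ[t][∂]`, acting on each coefficient. -/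
noncomputable def mapCoeff (E : Module.End ℂ ℂ[X]) : Module.End ℂ ℂ[X][X] :=
  lsum fun i : ℕ => (monomial i : ℂ[X] →ₗ[ℂ[X]] ℂ[X][X]).restrictScalars ℂ ∘ₗ E

theorem mapCoeff_monomial (E : Module.End ℂ ℂ[X]) (n : ℕ) (f : ℂ[X]) :
    mapCoeff E (monomial n f) = monomial n (E f) := by
  simp only [mapCoeff, lsum_apply]
  rw [sum_monomial_index _ _ (by simp)]
  rfl

theorem mapCoeff_C (E : Module.End ℂ ℂ[X]) (f : ℂ[X]) : mapCoeff E (C f) = C (E f) :=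
  mapCoeff_monomial E 0 f

theorem coeff_mapCoeff (E : Module.End ℂ ℂ[X]) (g : ℂ[X][X]) (n : ℕ) :
    (mapCoeff E g).coeff n = E (g.coeff n) := by
  induction g using Polynomial.induction_on' with
  | add p q hp hq => rw [map_add, coeff_add, hp, hq, coeff_add, map_add]
  | monomial m f =>
    rw [mapCoeff_monomial, coeff_monomial, coeff_monomial]
    split_ifs
    · rfl
    · rw [map_zero]

theorem natDegree_mapCoeff_le (E : Module.End ℂ ℂ[X]) (g : ℂ[X][X]) :
    (mapCoeff E g).natDegree ≤ g.natDegree := by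
  refine natDegree_le_iff_coeff_eq_zero.mpr fun n hn => ?_
  rw [coeff_mapCoeff, coeff_eq_zero_of_natDegree_lt hn, map_zero]

/-- The part of `omegaTwoAux` linear in `m`. -/
noncomputable def omegaTwoLinear (α : ℂ) (h : ℂ[X]) : Module.End ℂ ℂ[X] :=
  LinearMap.mulLeft ℂ (h + C α * diffQuot α h) - LinearMap.mulLeft ℂ X ∘ₗ derivative

/-- The part of `omegaTwoAux` quadratic in `m`. -/
noncomputable def omegaTwoQuadratic (α : ℂ) (h : ℂ[X]) : Module.End ℂ ℂ[X] :=
  α • (derivative - LinearMap.mulLeft ℂ (diffQuot α h))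

theorem omegaTwoAux_eq (α : ℂ) (h : ℂ[X]) (m : ℤ) (f : ℂ[X]) :
    omegaTwoAux α h m f = (m : ℂ) • omegaTwoLinear α h f +
      ((m : ℂ) ^ 2) • omegaTwoQuadratic α h f := by
  change C (m : ℂ) * h * f - C ((m : ℂ) * ((m : ℂ) - 1) * α) * diffQuot α h * f
    - C (m : ℂ) * (X - C ((m : ℂ) * α)) * derivative f =
    (m : ℂ) • ((h + C α * diffQuot α h) * f - X * derivative f) +
      ((m : ℂ) ^ 2) • (α • (derivative f - diffQuot α h * f))
  simp only [smul_eq_C_mul, map_mul, map_sub, map_pow, map_one]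
  ring

theorem smul_eq_C_C_mul (a : ℂ) (P : ℂ[X][X]) : a • P = C (C a) * P := by
  ext n : 1
  simp [coeff_C_mul, smul_eq_C_mul]

theorem omegaTwoOp_apply (lam : ℂˣ) (α : ℂ) (h : ℂ[X]) (m : ℤ) (g : ℂ[X][X]) :
    omegaTwoOp lam α h m g = ((lam : ℂ) ^ m) •
      (X * g.comp (X - C (C (m : ℂ))) +
        (m : ℂ) • (mapCoeff (omegaTwoLinear α h) g).comp (X - C (C (m : ℂ))) +
        ((m : ℂ) ^ 2) • (mapCoeff (omegaTwoQuadratic α h) g).comp (X - C (C (m : ℂ)))) := by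
  induction g using Polynomial.induction_on' with
  | add p q hp hq =>
    simp only [map_add, hp, hq, add_comp, smul_add, mul_add]
    abel
  | monomial n f =>
    have e := omegaTwoOp_map_mul_C lam α h m (X ^ n) f
    simp only [Polynomial.map_pow, map_X, X_pow_comp] at e
    rw [mul_comm, C_mul_X_pow_eq_monomial] at e
    rw [e, mapCoeff_monomial, mapCoeff_monomial, monomial_comp, monomial_comp, monomial_comp,
      omegaTwoAux_eq, map_add]
    congr 1
    have sm : ∀ (a : ℂ) (f : ℂ[X]) (P : ℂ[X][X]), a • (C f * P) = P * C (a • f) := by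
      intro a f P
      rw [← smul_mul_assoc, smul_C, mul_comm]
    rw [sm, sm]
    ring

/-- The Hasse derivative with respect to `∂`, as a complex linear operator on `ℂ[t][∂]`. -/
noncomputable def hasseOp (r : ℕ) : Module.End ℂ ℂ[X][X] :=
  (hasseDeriv r : ℂ[X][X] →ₗ[ℂ[X]] ℂ[X][X]).restrictScalars ℂ

/-- The coefficient of `k ^ r` in the operator `λ ^ (-k) d k` on `Ω(λ, α, h)`. -/
noncomputable def omegaTwoCoeff (α : ℂ) (h : ℂ[X]) : ℕ → Module.End ℂ ℂ[X][X]
  | 0 => LinearMap.mulLeft ℂ X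
  | 1 => -(LinearMap.mulLeft ℂ X ∘ₗ hasseOp 1) + mapCoeff (omegaTwoLinear α h)
  | r + 2 => ((-1 : ℂ) ^ r) • (LinearMap.mulLeft ℂ X ∘ₗ hasseOp (r + 2) -
      hasseOp (r + 1) ∘ₗ mapCoeff (omegaTwoLinear α h) +
      hasseOp r ∘ₗ mapCoeff (omegaTwoQuadratic α h))

theorem omegaTwoOp_eq_sum (lam : ℂˣ) (α : ℂ) (h : ℂ[X]) (m : ℤ) (g : ℂ[X][X]) (N : ℕ)
    (hN : g.natDegree < N) :
    omegaTwoOp lam α h m g = ((lam : ℂ) ^ m) •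
      ∑ r ∈ Finset.range (N + 2), ((m : ℂ) ^ r) • omegaTwoCoeff α h r g := by
  rw [omegaTwoOp_apply]
  congr 1
  have sh : ∀ (f : ℂ[X][X]) (M : ℕ), f.natDegree < M → f.comp (X - C (C (m : ℂ))) =
      ∑ r ∈ Finset.range M, ((-(m : ℂ)) ^ r) • hasseOp r f := by
    intro f M hM
    rw [comp_X_sub_C_eq_sum_hasseDeriv f _ M hM]
    refine Finset.sum_congr rfl fun r _ => ?_
    rw [← map_neg, ← map_pow, smul_eq_C_C_mul]
    rfl
  have d1 := natDegree_mapCoeff_le (omegaTwoLinear α h) g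
  have d2 := natDegree_mapCoeff_le (omegaTwoQuadratic α h) g
  rw [sh g (N + 2) (by omega), sh _ (N + 1) (lt_of_le_of_lt d1 (by omega)),
    sh _ N (lt_of_le_of_lt d2 hN)]
  have two : ∀ u : ℕ → ℂ[X][X], ∑ r ∈ Finset.range (N + 2), u r =
      ∑ r ∈ Finset.range N, u (r + 2) + u 1 + u 0 := fun u => by
    rw [Finset.sum_range_succ', Finset.sum_range_succ']
  rw [two, two, Finset.sum_range_succ' _ N]
  have key : ∀ r, ((m : ℂ) ^ (r + 2)) • omegaTwoCoeff α h (r + 2) g =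
      X * (((-(m : ℂ)) ^ (r + 2)) • hasseOp (r + 2) g) +
      (m : ℂ) • (((-(m : ℂ)) ^ (r + 1)) • hasseOp (r + 1) (mapCoeff (omegaTwoLinear α h) g)) +
      ((m : ℂ) ^ 2) • (((-(m : ℂ)) ^ r) • hasseOp r (mapCoeff (omegaTwoQuadratic α h) g)) := by
    intro r
    change ((m : ℂ) ^ (r + 2)) • (((-1 : ℂ) ^ r) • (X * hasseOp (r + 2) g -
      hasseOp (r + 1) (mapCoeff (omegaTwoLinear α h) g) +
      hasseOp r (mapCoeff (omegaTwoQuadratic α h) g))) = _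
    simp only [smul_add, smul_sub, mul_smul_comm, smul_smul]
    rw [neg_pow (m : ℂ), neg_pow (m : ℂ) (r + 1), neg_pow (m : ℂ) r]
    match_scalars <;> ring
  have key0 : ((m : ℂ) ^ 0) • omegaTwoCoeff α h 0 g = X * (((-(m : ℂ)) ^ 0) • hasseOp 0 g) := by
    simp [omegaTwoCoeff, hasseOp]
  have key1 : ((m : ℂ) ^ 1) • omegaTwoCoeff α h 1 g = X * (((-(m : ℂ)) ^ 1) • hasseOp 1 g) +
      (m : ℂ) • (((-(m : ℂ)) ^ 0) • hasseOp 0 (mapCoeff (omegaTwoLinear α h) g)) := by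
    change ((m : ℂ) ^ 1) • (-(X * hasseOp 1 g) + mapCoeff (omegaTwoLinear α h) g) = _
    have : hasseOp 0 (mapCoeff (omegaTwoLinear α h) g) = mapCoeff (omegaTwoLinear α h) g := by
      simp [hasseOp]
    rw [this]
    simp only [smul_eq_C_C_mul, map_neg, map_one, pow_one, pow_zero]
    ring
  simp only [key, key0, key1, Finset.sum_add_distrib, mul_add, smul_add, Finset.mul_sum,
    Finset.smul_sum]
  abel

theorem hasseOp_of_natDegree_lt {g : ℂ[X][X]} {r : ℕ} (hr : g.natDegree < r) :
    hasseOp r g = 0 :=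
  hasseDeriv_eq_zero_of_lt_natDegree g r hr

theorem omegaTwoCoeff_eq_zero (α : ℂ) (h : ℂ[X]) (g : ℂ[X][X]) (r : ℕ)
    (hr : g.natDegree + 2 < r) : omegaTwoCoeff α h r g = 0 := by
  obtain ⟨r, rfl⟩ : ∃ s, r = s + 2 := ⟨r - 2, by omega⟩
  have d1 := natDegree_mapCoeff_le (omegaTwoLinear α h) g
  have d2 := natDegree_mapCoeff_le (omegaTwoQuadratic α h) g
  simp [omegaTwoCoeff, hasseOp_of_natDegree_lt (g := g) (r := r + 2) (by omega),
    hasseOp_of_natDegree_lt (r := r + 1) (lt_of_le_of_lt d1 (by omega)),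
    hasseOp_of_natDegree_lt (r := r) (lt_of_le_of_lt d2 (by omega))]

/-- For degree reasons only the quadratic part survives, and what remains is free of `∂`. -/
theorem omegaTwoCoeff_of_natDegree_le (α : ℂ) (h : ℂ[X]) (g : ℂ[X][X]) (n : ℕ)
    (hn : g.natDegree ≤ n) :
    omegaTwoCoeff α h (n + 2) g = ((-1 : ℂ) ^ n) • C (omegaTwoQuadratic α h (g.coeff n)) := by
  have d1 := natDegree_mapCoeff_le (omegaTwoLinear α h) g
  have d2 := natDegree_mapCoeff_le (omegaTwoQuadratic α h) g
  have h2 : hasseOp n (mapCoeff (omegaTwoQuadratic α h) g) =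
      C (omegaTwoQuadratic α h (g.coeff n)) := by
    rw [← coeff_mapCoeff]
    exact hasseDeriv_natDegree_le (d2.trans hn)
  simp [omegaTwoCoeff, hasseOp_of_natDegree_lt (g := g) (r := n + 2) (by omega),
    hasseOp_of_natDegree_lt (r := n + 1) (lt_of_le_of_lt d1 (by omega)), h2]

theorem omegaTwoCoeff_one_C (α : ℂ) (h : ℂ[X]) (f : ℂ[X]) :
    omegaTwoCoeff α h 1 (C f) = C (omegaTwoLinear α h f) := by
  simp [omegaTwoCoeff, hasseOp_of_natDegree_lt (g := C f) (r := 1) (by simp), mapCoeff_C]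

theorem omegaTwoCoeff_two_C (α : ℂ) (h : ℂ[X]) (f : ℂ[X]) :
    omegaTwoCoeff α h 2 (C f) = C (omegaTwoQuadratic α h f) := by
  simpa using omegaTwoCoeff_of_natDegree_le α h (C f) 0 (by simp)

theorem diffQuot_of_degree_one (α : ℂ) (h : ℂ[X]) (hdeg : h.degree = 1) :
    diffQuot α h = C (h.coeff 1) ∧ h.coeff 1 ≠ 0 ∧ h = C (h.coeff 1) * X + C (h.coeff 0) := by
  have hh := eq_X_add_C_of_degree_le_one hdeg.le
  refine ⟨?_, ?_, hh⟩
  · refine mul_left_cancel₀ (X_sub_C_ne_zero α) ?_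
    rw [diffQuot_spec]
    generalize h.coeff 1 = a at hh ⊢
    generalize h.coeff 0 = b at hh
    subst hh
    simp
    ring
  · exact coeff_ne_zero_of_eq_degree hdeg

/-- The difference quotient is the nonzero leading coefficient `a` of `h`, and `f' = a f` has no
nonzero polynomial solution, by degree. -/
theorem omegaTwoQuadratic_injective (α : ℂ) (hα : α ≠ 0) (h : ℂ[X]) (hdeg : h.degree = 1)
    (f : ℂ[X]) (hf : omegaTwoQuadratic α h f = 0) : f = 0 := by
  obtain ⟨hq, ha, -⟩ := diffQuot_of_degree_one α h hdeg
  by_contra hf0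
  simp only [omegaTwoQuadratic, hq, LinearMap.smul_apply, LinearMap.sub_apply,
    LinearMap.mulLeft_apply, smul_eq_zero, hα, false_or, sub_eq_zero] at hf
  have h1 := degree_derivative_lt hf0
  rw [hf, degree_C_mul ha] at h1
  exact lt_irrefl _ h1

/-- Two rounds of compression. With `n` the maximal `∂`-degree in `F`, the coefficient operator of
index `n + 2` maps `F` into `ℂ[t]` and is nonzero there. Repeated differentiation in `t`, available
in the algebra, then leads to constants. -/
theorem omegaTwo_contractsTo (α : ℂ) (hα : α ≠ 0) (h : ℂ[X]) (hdeg : h.degree = 1) :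
    ContractsTo (Algebra.adjoin ℂ (Set.range (omegaTwoCoeff α h))) (1 : ℂ[X][X]) := by
  intro F hfd hF
  obtain ⟨hq, -, -⟩ := diffQuot_of_degree_one α h hdeg
  obtain ⟨n, hn, p, hp, hpn⟩ := exists_max_natDegree F hfd hF
  let φ : ℂ[X][X] →ₗ[ℂ] ℂ[X] :=
    omegaTwoQuadratic α h ∘ₗ (lcoeff ℂ[X] n).restrictScalars ℂ
  have hφp : φ p ≠ 0 := fun h0 => hpn (omegaTwoQuadratic_injective α hα h hdeg _ h0)
  obtain ⟨m, hm, f, hf, hfm⟩ := exists_max_natDegree (F.map φ) inferInstance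
    ((Submodule.ne_bot_iff _).mpr ⟨φ p, ⟨p, hp, rfl⟩, hφp⟩)
  obtain ⟨g, hg, rfl⟩ := hf
  let A := Algebra.adjoin ℂ (Set.range (omegaTwoCoeff α h))
  have hD : ∀ r, omegaTwoCoeff α h r ∈ A := fun r => Algebra.subset_adjoin ⟨r, rfl⟩
  -- On `ℂ[t]` the coefficient operator of index `2` is `α (d/dt - a)` with `a = h.coeff 1`, so `B`
  -- restricts to `d/dt`.
  let B : Module.End ℂ ℂ[X][X] := α⁻¹ • omegaTwoCoeff α h 2 + h.coeff 1 • 1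
  have hB : B ∈ A := A.add_mem (A.smul_mem (hD 2) _) (A.smul_mem A.one_mem _)
  have hBC : ∀ f : ℂ[X], B (C f) = C (derivative f) := by
    intro f
    simp only [B, LinearMap.add_apply, LinearMap.smul_apply, Module.End.one_apply,
      omegaTwoCoeff_two_C, smul_C, ← map_add]
    congr 1
    simp only [omegaTwoQuadratic, hq, LinearMap.smul_apply, LinearMap.sub_apply,
      LinearMap.mulLeft_apply]
    rw [smul_smul, inv_mul_cancel₀ hα, one_smul, smul_eq_C_mul, sub_add_cancel]
  have hBpow : ∀ (k : ℕ) (f : ℂ[X]), (B ^ k) (C f) = C (derivative^[k] f) := by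
    intro k f
    induction k with
    | zero => simp
    | succ k ih => rw [pow_succ', Module.End.mul_apply, ih, hBC, Function.iterate_succ_apply']
  have key : ∀ x ∈ F, (B ^ m * omegaTwoCoeff α h (n + 2)) x =
      ((-1 : ℂ) ^ n * m.factorial * (φ x).coeff m) • 1 := by
    intro x hx
    have h1 : omegaTwoQuadratic α h (x.coeff n) = φ x := rfl
    rw [Module.End.mul_apply, omegaTwoCoeff_of_natDegree_le α h x n (hn x hx), map_smul, hBpow,
      h1, ← factorial_smul_hasseDeriv, LinearMap.smul_apply,
      hasseDeriv_natDegree_le (hm _ ⟨x, hx, rfl⟩)]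
    have h2 : (1 : ℂ[X][X]) = C (C 1) := by simp
    rw [h2, smul_C, smul_C, smul_C, smul_C, nsmul_eq_mul, smul_eq_mul, smul_C, smul_eq_mul,
      mul_one, mul_assoc]
  refine ⟨B ^ m * omegaTwoCoeff α h (n + 2), A.mul_mem (A.pow_mem hB m) (hD _), fun x hx => ?_,
    g, hg, ?_⟩
  · rw [key x hx]
    exact Submodule.smul_mem _ _ (Submodule.mem_span_singleton_self _)
  · rw [key g hg]
    refine smul_ne_zero (mul_ne_zero (mul_ne_zero (by simp) ?_) hfm) one_ne_zero
    exact_mod_cast m.factorial_ne_zero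

/-- The coefficient operator of index `1` raises the `t`-degree: it maps `t ^ n` to `a t ^ (n + 1)`
plus a multiple of `t ^ n`, with `a ≠ 0`. That of index `0` is multiplication by `∂`. -/
theorem omegaTwo_generates (α : ℂ) (h : ℂ[X]) (hdeg : h.degree = 1) :
    Generates (Algebra.adjoin ℂ (Set.range (omegaTwoCoeff α h))) (1 : ℂ[X][X]) := by
  obtain ⟨hq, ha, hh⟩ := diffQuot_of_degree_one α h hdeg
  refine generates_of_submodule fun P hP h1 => ?_
  have hD : ∀ r, ∀ p ∈ P, omegaTwoCoeff α h r p ∈ P := fun r =>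
    hP _ (Algebra.subset_adjoin ⟨r, rfl⟩)
  have hpow : ∀ n : ℕ, (C (X ^ n) : ℂ[X][X]) ∈ P := by
    intro n
    induction n with
    | zero => simpa using h1
    | succ n ih =>
      have h2 := hD 1 _ ih
      rw [omegaTwoCoeff_one_C] at h2
      have e : (X ^ (n + 1) : ℂ[X]) = (h.coeff 1)⁻¹ • (omegaTwoLinear α h (X ^ n) -
          (h.coeff 0 + α * h.coeff 1 - n) • X ^ n) := by
        have e1 : omegaTwoLinear α h (X ^ n) - (h.coeff 0 + α * h.coeff 1 - n) • X ^ n =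
            h.coeff 1 • X ^ (n + 1) := by
          simp only [omegaTwoLinear, hq, LinearMap.sub_apply, LinearMap.comp_apply,
            LinearMap.mulLeft_apply, derivative_X_pow, smul_eq_C_mul]
          generalize h.coeff 1 = a at hh ⊢
          generalize h.coeff 0 = b at hh ⊢
          subst hh
          rcases n with _ | n
          · simp
          · simp only [map_add, map_sub, map_mul, map_natCast, Nat.add_sub_cancel]
            ring
        rw [e1, smul_smul, inv_mul_cancel₀ ha, one_smul]
      rw [e, ← smul_C, map_sub, ← smul_C]
      exact P.smul_mem _ (P.sub_mem h2 (P.smul_mem _ ih))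
  have hC : ∀ f : ℂ[X], C f ∈ P := by
    intro f
    rw [f.as_sum_range_C_mul_X_pow, map_sum]
    refine P.sum_mem fun n _ => ?_
    rw [← smul_eq_C_mul, ← smul_C]
    exact P.smul_mem _ (hpow n)
  refine Submodule.eq_top_iff'.mpr fun g => ?_
  rw [g.as_sum_range_C_mul_X_pow]
  refine P.sum_mem fun n hn => ?_
  clear hn
  generalize g.coeff n = f
  induction n with
  | zero => simpa using hC f
  | succ n ih =>
    have := hD 0 _ ih
    rwa [pow_succ', mul_left_comm]

theorem omegaTwo_hasExpansion (lam : ℂˣ) (α : ℂ) (h : ℂ[X]) :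
    HasExpansion (OmegaTwo lam α h) lam (omegaTwoCoeff α h) := by
  intro p
  refine ⟨natDegree (R := ℂ[X]) p + 3, fun r hr => omegaTwoCoeff_eq_zero α h p r (by omega),
    fun k => ?_⟩
  refine (omegaTwo_d lam α h k p).trans ?_
  rw [omegaTwoOp_eq_sum lam α h k p _ (Nat.lt_succ_self _)]
  simp only [zpow_natCast, Int.cast_natCast]
  rfl

end Two

end Vir

/-! ### Operators on tensor products -/

section TensorOperators

open PiTensorProduct

variable {ι : Type*} [Fintype ι] [DecidableEq ι] {s : ι → Type*} [∀ i, AddCommGroup (s i)]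
  [∀ i, Module ℂ (s i)]

/-- The action of the operators on the `i`-th factor on a finite tensor product. -/
noncomputable def factorHom (i : ι) :
    Module.End ℂ (s i) →ₐ[ℂ] Module.End ℂ (⨂[ℂ] i, s i) :=
  AlgHom.ofLinearMap
    ((PiTensorProduct.mapMultilinear ℂ s s).toLinearMap (fun _ => LinearMap.id) i)
    (by
      change PiTensorProduct.map (Function.update (fun _ => LinearMap.id) i LinearMap.id) = 1
      rw [Function.update_eq_self_iff.mpr rfl]
      exact PiTensorProduct.map_id)
    (fun a b => by
      change PiTensorProduct.map _ = PiTensorProduct.map _ * PiTensorProduct.map _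
      rw [← PiTensorProduct.map_mul]
      congr 1
      funext j
      rcases eq_or_ne j i with rfl | h
      · simp
      · simp [h]; rfl)

theorem factorHom_apply (i : ι) (a : Module.End ℂ (s i)) :
    factorHom i a = PiTensorProduct.map (Function.update (fun _ => LinearMap.id) i a) := rfl

theorem factorHom_tprod (i : ι) (a : Module.End ℂ (s i)) (f : ∀ i, s i) :
    factorHom i a (tprod ℂ f) = tprod ℂ (Function.update f i (a (f i))) := by
  rw [factorHom_apply, PiTensorProduct.map_tprod]
  congr 1
  funext j
  rcases eq_or_ne j i with rfl | h
  · simp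
  · simp [h]

theorem factorHom_commute {i j : ι} (hij : i ≠ j) (a : Module.End ℂ (s i))
    (b : Module.End ℂ (s j)) : Commute (factorHom i a) (factorHom j b) := by
  refine PiTensorProduct.ext (MultilinearMap.ext fun f => ?_)
  simp only [LinearMap.compMultilinearMap_apply, Module.End.mul_apply, factorHom_tprod,
    Function.update_of_ne hij, Function.update_of_ne hij.symm]
  rw [Function.update_comm hij]

/-- Every vector is supported on a finite-dimensional subspace. -/
def LocallySupported {X Z : Type*} [AddCommGroup X] [Module ℂ X] [AddCommGroup Z] [Module ℂ Z]
    (T : Module.End ℂ X →ₐ[ℂ] Module.End ℂ Z) : Prop :=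
  ∀ w, ∃ F : Submodule ℂ X, FiniteDimensional ℂ F ∧ SupportedOn T w F

section Supports

variable {X Z : Type*} [AddCommGroup X] [Module ℂ X] [AddCommGroup Z] [Module ℂ Z]
  {T : Module.End ℂ X →ₐ[ℂ] Module.End ℂ Z}

theorem exists_supportedOn_add {w w' : Z}
    (h : ∃ F : Submodule ℂ X, FiniteDimensional ℂ F ∧ SupportedOn T w F)
    (h' : ∃ F : Submodule ℂ X, FiniteDimensional ℂ F ∧ SupportedOn T w' F) :
    ∃ F : Submodule ℂ X, FiniteDimensional ℂ F ∧ SupportedOn T (w + w') F := by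
  obtain ⟨F, hF, hw⟩ := h
  obtain ⟨G, hG, hw'⟩ := h'
  refine ⟨F ⊔ G, inferInstance, fun a ha => ?_⟩
  rw [map_add, hw.mono le_sup_left a ha, hw'.mono le_sup_right a ha, add_zero]

theorem exists_supportedOn_zero :
    ∃ F : Submodule ℂ X, FiniteDimensional ℂ F ∧ SupportedOn T 0 F :=
  ⟨⊥, inferInstance, fun _ _ => map_zero _⟩

theorem LocallySupported.rTensor (hT : LocallySupported T) (N : Type*) [AddCommGroup N]
    [Module ℂ N] : LocallySupported ((Module.End.rTensorAlgHom ℂ Z N).comp T) := by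
  intro w
  induction w using TensorProduct.induction_on with
  | zero => exact exists_supportedOn_zero
  | add x y hx hy => exact exists_supportedOn_add hx hy
  | tmul x y =>
    obtain ⟨F, hF, hx⟩ := hT x
    refine ⟨F, hF, fun a ha => ?_⟩
    change T a x ⊗ₜ y = 0
    rw [hx a ha, TensorProduct.zero_tmul]

theorem LocallySupported.lTensor (hT : LocallySupported T) (N : Type*) [AddCommGroup N]
    [Module ℂ N] : LocallySupported ((Module.End.lTensorAlgHom ℂ Z N).comp T) := by
  intro w
  induction w using TensorProduct.induction_on with
  | zero => exact exists_supportedOn_zero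
  | add x y hx hy => exact exists_supportedOn_add hx hy
  | tmul y x =>
    obtain ⟨F, hF, hx⟩ := hT x
    refine ⟨F, hF, fun a ha => ?_⟩
    change y ⊗ₜ T a x = 0
    rw [hx a ha, TensorProduct.tmul_zero]

theorem locallySupported_factorHom (i : ι) : LocallySupported (factorHom (s := s) i) := by
  intro w
  induction w using PiTensorProduct.induction_on with
  | add x y hx hy => exact exists_supportedOn_add hx hy
  | smul_tprod r f =>
    refine ⟨Submodule.span ℂ {f i}, inferInstance, fun a ha => ?_⟩
    rw [map_smul, factorHom_tprod, ha _ (Submodule.mem_span_singleton_self _),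
      MultilinearMap.map_update_zero, smul_zero]

end Supports

/-- A linear map sending everything to multiples of `x`, in each factor, does so on the tensor
product. -/
theorem map_mem_span_tprod (ε : ∀ i, Module.End ℂ (s i)) (x : ∀ i, s i)
    (h : ∀ i y, ε i y ∈ Submodule.span ℂ {x i}) (w : ⨂[ℂ] i, s i) :
    PiTensorProduct.map ε w ∈ Submodule.span ℂ {tprod ℂ x} := by
  induction w using PiTensorProduct.induction_on with
  | add x y hx hy => rw [map_add]; exact Submodule.add_mem _ hx hy
  | smul_tprod r f =>
    choose c hc using fun i => Submodule.mem_span_singleton.mp (h i (f i))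
    rw [map_smul, PiTensorProduct.map_tprod]
    simp only [← hc, MultilinearMap.map_smul_univ]
    exact Submodule.smul_mem _ _ (Submodule.smul_mem _ _ (Submodule.mem_span_singleton_self _))

/-- `PiTensorProduct.map ε` is the product of the one-factor operators, each of which fixes `w`. -/
theorem map_eq_of_forall_factorHom {Z : Type*} [AddCommGroup Z] [Module ℂ Z]
    (Θ : Module.End ℂ (⨂[ℂ] i, s i) →ₐ[ℂ] Module.End ℂ Z) (ε : ∀ i, Module.End ℂ (s i)) (w : Z)
    (h : ∀ i, Θ (factorHom i (ε i)) w = w) : Θ (PiTensorProduct.map ε) w = w := by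
  have key : ∀ S : Finset ι,
      Θ (PiTensorProduct.map (S.piecewise ε fun _ => LinearMap.id)) w = w := by
    intro S
    induction S using Finset.induction_on with
    | empty =>
      rw [Finset.piecewise_empty, PiTensorProduct.map_id]
      exact congrArg (fun f : Module.End ℂ Z => f w) (map_one Θ)
    | insert i S hi ih =>
      have e : PiTensorProduct.map ((insert i S).piecewise ε fun _ => LinearMap.id) =
          factorHom i (ε i) * PiTensorProduct.map (S.piecewise ε fun _ => LinearMap.id) := by
        rw [factorHom_apply, ← PiTensorProduct.map_mul]
        congr 1
        funext j
        rcases eq_or_ne j i with rfl | hj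
        · simp [hi]
          rfl
        · simp only [Finset.piecewise, Finset.mem_insert, hj, false_or, Function.update_of_ne hj]
          rfl
      rw [e, map_mul, Module.End.mul_apply, ih, h]
  simpa using key Finset.univ

theorem tprod_ne_zero {x : ∀ i, s i} (hx : ∀ i, x i ≠ 0) : tprod ℂ x ≠ 0 := by
  have : ∀ i, ∃ f : s i →ₗ[ℂ] ℂ, f (x i) ≠ 0 := fun i => by
    by_contra! h
    exact hx i ((Module.forall_dual_apply_eq_zero_iff ℂ (x i)).mp h)
  choose f hf using this
  intro h
  have h1 := congrArg (PiTensorProduct.lift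
    ((MultilinearMap.mkPiAlgebra ℂ ι ℂ).compLinearMap f)) h
  rw [PiTensorProduct.lift.tprod, map_zero, MultilinearMap.compLinearMap_apply,
    MultilinearMap.mkPiAlgebra_apply, Finset.prod_eq_zero_iff] at h1
  obtain ⟨i, -, hi⟩ := h1
  exact hf i hi

/-- Starting from `tprod x`, operators on the factors reach every pure tensor. -/
theorem tprod_mem_of_generates {Z : Type*} [AddCommGroup Z] [Module ℂ Z]
    (Φ : (⨂[ℂ] i, s i) →ₗ[ℂ] Z) (W : Submodule ℂ Z)
    (A : ∀ i, Subalgebra ℂ (Module.End ℂ (s i))) (x : ∀ i, s i)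
    (hA : ∀ i, Vir.Generates (A i) (x i))
    (hst : ∀ i, ∀ b ∈ A i, ∀ w, Φ w ∈ W → Φ (factorHom i b w) ∈ W)
    (hx : Φ (tprod ℂ x) ∈ W) (w : ⨂[ℂ] i, s i) : Φ w ∈ W := by
  induction w using PiTensorProduct.induction_on with
  | add x y hx hy => rw [map_add]; exact W.add_mem hx hy
  | smul_tprod r f =>
    rw [map_smul]
    refine W.smul_mem r ?_
    -- The entries `x i` are replaced by `f i` one factor at a time.
    have key : ∀ S : Finset ι, Φ (tprod ℂ (S.piecewise f x)) ∈ W := by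
      intro S
      induction S using Finset.induction_on with
      | empty => simpa using hx
      | insert i S hi ih =>
        obtain ⟨b, hb, hbx⟩ := hA i (f i)
        have := hst i b hb _ ih
        rwa [factorHom_tprod, Finset.piecewise_eq_of_notMem _ _ _ hi, hbx,
          ← Finset.piecewise_insert] at this
    simpa using key Finset.univ

end TensorOperators

/-! ### Fixed vectors in stable subspaces -/

/-- If each of several families of operators can move any nonzero vector to a nonzero vector
fixed by the corresponding projection, then a nonzero stable subspace contains a nonzero vector
fixed by all projections. -/
theorem exists_fixed_vector {ι Z : Type*} [Finite ι] [AddCommGroup Z] [Module ℂ Z]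
    (A : ι → Subalgebra ℂ (Module.End ℂ Z)) (π : ι → Module.End ℂ Z)
    (hcomm : ∀ i j, i ≠ j → ∀ a ∈ A i, Commute a (π j))
    (hfix : ∀ i w, w ≠ 0 → ∃ a ∈ A i, a w ≠ 0 ∧ π i (a w) = a w)
    (W : Submodule ℂ Z) (hW : W ≠ ⊥) (hst : ∀ i, ∀ a ∈ A i, ∀ w ∈ W, a w ∈ W) :
    ∃ w ∈ W, w ≠ 0 ∧ ∀ i, π i w = w := by
  classical
  have := Fintype.ofFinite ι
  have key : ∀ S : Finset ι, ∃ w ∈ W, w ≠ 0 ∧ ∀ i ∈ S, π i w = w := by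
    intro S
    induction S using Finset.induction_on with
    | empty =>
      obtain ⟨w, hw, hw0⟩ := Submodule.exists_mem_ne_zero_of_ne_bot hW
      exact ⟨w, hw, hw0, by simp⟩
    | insert i S hi ih =>
      obtain ⟨w, hw, hw0, hS⟩ := ih
      obtain ⟨a, ha, ha0, hπ⟩ := hfix i w hw0
      refine ⟨a w, hst i a ha w hw, ha0, fun j hj => ?_⟩
      rcases Finset.mem_insert.mp hj with rfl | hj
      · exact hπ
      -- The new operator commutes with the earlier projections, so their fixed-point equations
      -- persist.
      · have hij : i ≠ j := fun h => hi (h ▸ hj)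
        have := LinearMap.congr_fun (hcomm i j hij a ha) w
        rw [Module.End.mul_apply, Module.End.mul_apply, hS j hj] at this
        exact this.symm
  obtain ⟨w, hw, hw0, h⟩ := key Finset.univ
  exact ⟨w, hw, hw0, fun i => h i (Finset.mem_univ i)⟩

/-! ### Tensor products of modules with exponential expansions -/

namespace Vir

open PiTensorProduct

/-- The properties of `Ω(μ, β)` and `Ω(λ, α, h)` responsible for the irreducibility of tensor
products. -/
structure IsExpModule (X : Type*) [AddCommGroup X] [Module ℂ X]
    [LieRingModule Vir X] (a : ℂ) (D : ℕ → Module.End ℂ X) (x₀ : X) : Prop where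
  expansion : HasExpansion X a D
  contracts : ContractsTo (Algebra.adjoin ℂ (Set.range D)) x₀
  generates : Generates (Algebra.adjoin ℂ (Set.range D)) x₀
  ne_zero : x₀ ≠ 0

section Expansion

variable {X Z : Type*} [AddCommGroup X] [Module ℂ X] [LieRingModule Vir X] [LieModule ℂ Vir X]
  [AddCommGroup Z] [Module ℂ Z] {a : ℂ} {D : ℕ → Module.End ℂ X}

theorem HasExpansion.uniform (h : HasExpansion X a D) (F : Submodule ℂ X)
    (hF : FiniteDimensional ℂ F) : ∃ N₀, ∀ N, N₀ ≤ N → ∀ k : ℕ, ∀ x ∈ F,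
      ⁅d k, x⁆ = (a ^ k) • ∑ r ∈ Finset.range N, ((k : ℂ) ^ r) • D r x := by
  classical
  obtain ⟨S, rfl⟩ := (Submodule.fg_iff_finiteDimensional F).mpr hF
  choose N hN hexp using h
  refine ⟨S.sup N, fun M hM k => ?_⟩
  have hle : Submodule.span ℂ (S : Set X) ≤ LinearMap.ker (LieModule.toEnd ℂ Vir X (d k) -
      (a ^ k) • ∑ r ∈ Finset.range M, ((k : ℂ) ^ r) • D r) := by
    rw [Submodule.span_le]
    intro x hx
    have hxM : N x ≤ M := (Finset.le_sup hx).trans hM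
    rw [SetLike.mem_coe, LinearMap.mem_ker, LinearMap.sub_apply, LieModule.toEnd_apply_apply,
      hexp x k, sub_eq_zero, LinearMap.smul_apply, LinearMap.sum_apply]
    congr 1
    refine Finset.sum_subset (Finset.range_mono hxM) fun r _ hr => ?_
    rw [hN x r (by simpa using hr), smul_zero]
  intro x hx
  have := hle hx
  rw [LinearMap.mem_ker, LinearMap.sub_apply, LieModule.toEnd_apply_apply, sub_eq_zero,
    LinearMap.smul_apply, LinearMap.sum_apply] at this
  exact this

/-- A vector of `Z` sees only a finite-dimensional part of `X`, on which one truncation order serves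
all vectors. Allowing every larger order lets different factors share a common one. -/
theorem HasExpansion.lift (h : HasExpansion X a D) (T : Module.End ℂ X →ₐ[ℂ] Module.End ℂ Z)
    (hT : LocallySupported T) (w : Z) : ∃ N₀, ∀ N, N₀ ≤ N → ∀ k : ℕ,
      T (LieModule.toEnd ℂ Vir X (d k)) w =
        (a ^ k) • ∑ r ∈ Finset.range N, ((k : ℂ) ^ r) • T (D r) w := by
  obtain ⟨F, hF, hw⟩ := hT w
  obtain ⟨N₀, hN⟩ := h.uniform F hF
  refine ⟨N₀, fun N hN' k => ?_⟩
  rw [hw.congr (b := (a ^ k) • ∑ r ∈ Finset.range N, ((k : ℂ) ^ r) • D r) fun x hx => by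
    rw [LinearMap.smul_apply, LinearMap.sum_apply]
    exact hN N hN' k x hx]
  simp only [map_smul, map_sum, LinearMap.smul_apply, LinearMap.sum_apply]

end Expansion

theorem exists_projection {X : Type*} [AddCommGroup X] [Module ℂ X] (x₀ : X) :
    ∃ ε : Module.End ℂ X, ε x₀ = x₀ ∧ ∀ y, ε y ∈ Submodule.span ℂ {x₀} := by
  obtain ⟨f, hf⟩ := LinearMap.exists_extend (LinearMap.id : Submodule.span ℂ {x₀} →ₗ[ℂ] _)
  refine ⟨(Submodule.span ℂ {x₀}).subtype ∘ₗ f, ?_, fun y => (f y).2⟩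
  have := LinearMap.congr_fun hf ⟨x₀, Submodule.mem_span_singleton_self _⟩
  exact congrArg Subtype.val this

theorem apply_mem_of_mem_adjoin {X Z : Type*} [AddCommGroup X] [Module ℂ X] [AddCommGroup Z]
    [Module ℂ Z] (T : Module.End ℂ X →ₐ[ℂ] Module.End ℂ Z) (D : ℕ → Module.End ℂ X)
    (W : Submodule ℂ Z) (h : ∀ r, ∀ w ∈ W, T (D r) w ∈ W) {b : Module.End ℂ X}
    (hb : b ∈ Algebra.adjoin ℂ (Set.range D)) : ∀ w ∈ W, T b w ∈ W := by
  induction hb using Algebra.adjoin_induction with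
  | mem x hx => obtain ⟨r, rfl⟩ := hx; exact h r
  | algebraMap c =>
    intro w hw
    rw [AlgHom.commutes, Module.algebraMap_end_apply]
    exact W.smul_mem c hw
  | add x y _ _ hx hy =>
    intro w hw
    rw [map_add]
    exact W.add_mem (hx w hw) (hy w hw)
  | mul x y _ _ hx hy =>
    intro w hw
    rw [map_mul]
    exact hx _ (hy w hw)

section Main

variable {ι κ : Type*} [Fintype ι] [DecidableEq ι] [Fintype κ] [DecidableEq κ]
  (s : ι → Type*) [∀ i, AddCommGroup (s i)] [∀ i, Module ℂ (s i)]
  [∀ i, LieRingModule Vir (s i)] [∀ i, LieModule ℂ Vir (s i)]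
  (t : κ → Type*) [∀ j, AddCommGroup (t j)] [∀ j, Module ℂ (t j)]
  [∀ j, LieRingModule Vir (t j)] [∀ j, LieModule ℂ Vir (t j)]
  (V : Type*) [AddCommGroup V] [Module ℂ V]

/-- Operators on the first tensor product acting on the triple tensor product. -/
noncomputable def leftHom : Module.End ℂ (⨂[ℂ] i, s i) →ₐ[ℂ]
    Module.End ℂ (((⨂[ℂ] i, s i) ⊗[ℂ] (⨂[ℂ] j, t j)) ⊗[ℂ] V) :=
  (Module.End.rTensorAlgHom ℂ _ V).comp (Module.End.rTensorAlgHom ℂ _ _)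

/-- Operators on the second tensor product acting on the triple tensor product. -/
noncomputable def middleHom : Module.End ℂ (⨂[ℂ] j, t j) →ₐ[ℂ]
    Module.End ℂ (((⨂[ℂ] i, s i) ⊗[ℂ] (⨂[ℂ] j, t j)) ⊗[ℂ] V) :=
  (Module.End.rTensorAlgHom ℂ _ V).comp (Module.End.lTensorAlgHom ℂ _ _)

theorem leftHom_tmul (a : Module.End ℂ (⨂[ℂ] i, s i)) (p : ⨂[ℂ] i, s i) (q : ⨂[ℂ] j, t j)
    (v : V) : leftHom s t V a ((p ⊗ₜ q) ⊗ₜ v) = (a p ⊗ₜ q) ⊗ₜ v := rfl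

theorem middleHom_tmul (a : Module.End ℂ (⨂[ℂ] j, t j)) (p : ⨂[ℂ] i, s i) (q : ⨂[ℂ] j, t j)
    (v : V) : middleHom s t V a ((p ⊗ₜ q) ⊗ₜ v) = (p ⊗ₜ a q) ⊗ₜ v := rfl

theorem leftHom_commute_middleHom (a : Module.End ℂ (⨂[ℂ] i, s i))
    (b : Module.End ℂ (⨂[ℂ] j, t j)) : Commute (leftHom s t V a) (middleHom s t V b) := by
  refine TensorProduct.ext_threefold fun p q v => ?_
  rw [Module.End.mul_apply, Module.End.mul_apply, leftHom_tmul, middleHom_tmul, middleHom_tmul,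
    leftHom_tmul]

theorem lie_eq_sum [LieRingModule Vir V] [LieModule ℂ Vir V] (x : Vir)
    (w : ((⨂[ℂ] i, s i) ⊗[ℂ] (⨂[ℂ] j, t j)) ⊗[ℂ] V) :
    ⁅x, w⁆ = ∑ i, leftHom s t V (factorHom i (LieModule.toEnd ℂ Vir (s i) x)) w +
      ∑ j, middleHom s t V (factorHom j (LieModule.toEnd ℂ Vir (t j) x)) w +
      (LieModule.toEnd ℂ Vir V x).lTensor _ w := by
  have hs : ∀ p : ⨂[ℂ] i, s i,
      ⁅x, p⁆ = ∑ i, factorHom i (LieModule.toEnd ℂ Vir (s i) x) p := fun p =>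
    LinearMap.sum_apply _ _ _
  have ht : ∀ p : ⨂[ℂ] j, t j,
      ⁅x, p⁆ = ∑ j, factorHom j (LieModule.toEnd ℂ Vir (t j) x) p := fun p =>
    LinearMap.sum_apply _ _ _
  have key : LieModule.toEnd ℂ Vir (((⨂[ℂ] i, s i) ⊗[ℂ] (⨂[ℂ] j, t j)) ⊗[ℂ] V) x =
      ∑ i, leftHom s t V (factorHom i (LieModule.toEnd ℂ Vir (s i) x)) +
      ∑ j, middleHom s t V (factorHom j (LieModule.toEnd ℂ Vir (t j) x)) +
      (LieModule.toEnd ℂ Vir V x).lTensor _ := by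
    refine TensorProduct.ext_threefold fun p q v => ?_
    rw [LieModule.toEnd_apply_apply, TensorProduct.LieModule.lie_tmul_right,
      TensorProduct.LieModule.lie_tmul_right, hs, ht]
    simp only [LinearMap.add_apply, LinearMap.sum_apply, leftHom_tmul, middleHom_tmul,
      LinearMap.lTensor_tmul, LieModule.toEnd_apply_apply, TensorProduct.add_tmul,
      TensorProduct.sum_tmul, TensorProduct.tmul_sum]
  have := LinearMap.congr_fun key w
  simpa only [LinearMap.add_apply, LinearMap.sum_apply, LieModule.toEnd_apply_apply] using this

theorem exists_forall_lTensor_eq_zero [LieRingModule Vir V] [LieModule ℂ Vir V]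
    (hV : ∀ v : V, ∃ R : ℕ, ∀ k : ℕ, R ≤ k → ⁅d k, v⁆ = 0)
    {M : Type*} [AddCommGroup M] [Module ℂ M] (w : M ⊗[ℂ] V) :
    ∃ R : ℕ, ∀ k : ℕ, R ≤ k → (LieModule.toEnd ℂ Vir V (d k)).lTensor M w = 0 := by
  induction w using TensorProduct.induction_on with
  | zero => exact ⟨0, fun k _ => map_zero _⟩
  | tmul x v =>
    obtain ⟨R, hR⟩ := hV v
    refine ⟨R, fun k hk => ?_⟩
    rw [LinearMap.lTensor_tmul, LieModule.toEnd_apply_apply, hR k hk, TensorProduct.tmul_zero]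
  | add x y hx hy =>
    obtain ⟨R, hR⟩ := hx
    obtain ⟨S, hS⟩ := hy
    exact ⟨max R S, fun k hk => by
      rw [map_add, hR k (le_of_max_le_left hk), hS k (le_of_max_le_right hk), add_zero]⟩

variable {s t V} [LieRingModule Vir V] [LieModule ℂ Vir V] {a : ι → ℂ} {b : κ → ℂ}
  {D : ∀ i, ℕ → Module.End ℂ (s i)} {D' : ∀ j, ℕ → Module.End ℂ (t j)}
  {x : ∀ i, s i} {y : ∀ j, t j}

/-- Submodules of the tensor product are stable under the coefficient operators of each
factor. -/
theorem coeff_mem_of_lie_mem (ha : ∀ i, a i ≠ 0) (hb : ∀ j, b j ≠ 0)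
    (hinj : Function.Injective (Sum.elim a b))
    (hs : ∀ i, HasExpansion (s i) (a i) (D i)) (ht : ∀ j, HasExpansion (t j) (b j) (D' j))
    (hV : ∀ v : V, ∃ R : ℕ, ∀ k : ℕ, R ≤ k → ⁅d k, v⁆ = 0)
    (W : Submodule ℂ (((⨂[ℂ] i, s i) ⊗[ℂ] (⨂[ℂ] j, t j)) ⊗[ℂ] V))
    (hW : ∀ (z : Vir), ∀ w ∈ W, ⁅z, w⁆ ∈ W) (r : ℕ)
    (w : ((⨂[ℂ] i, s i) ⊗[ℂ] (⨂[ℂ] j, t j)) ⊗[ℂ] V) (hw : w ∈ W) :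
    (∀ i, leftHom s t V (factorHom i (D i r)) w ∈ W) ∧
      ∀ j, middleHom s t V (factorHom j (D' j r)) w ∈ W := by
  have hs' := fun i => (hs i).lift ((leftHom s t V).comp (factorHom i))
    (((locallySupported_factorHom i).rTensor _).rTensor V) w
  have ht' := fun j => (ht j).lift ((middleHom s t V).comp (factorHom j))
    (((locallySupported_factorHom j).lTensor _).rTensor V) w
  choose N hN using hs'
  choose N' hN' using ht'
  obtain ⟨R, hR⟩ := exists_forall_lTensor_eq_zero V hV w
  let M := Finset.univ.sup N + Finset.univ.sup N' + r + 1
  have key := ExpPoly.coeff_mem W (Sum.elim a b) (by rintro (i | j); exacts [ha i, hb j]) hinj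
    (Sum.elim (fun i r => leftHom s t V (factorHom i (D i r)) w)
      (fun j r => middleHom s t V (factorHom j (D' j r)) w)) M R (by
    intro k hk
    have h1 := hW (d k) w hw
    -- For `k ≥ R` the contribution of `V` disappears, leaving an exponential polynomial in `k` with
    -- the distinct bases `a i` and `b j`.
    rw [lie_eq_sum, hR k hk, add_zero] at h1
    rw [Fintype.sum_sum_type]
    convert h1 using 2
    · refine Finset.sum_congr rfl fun i _ => (hN i M ?_ k).symm
      have := Finset.le_sup (f := N) (Finset.mem_univ i)
      omega
    · refine Finset.sum_congr rfl fun j _ => (hN' j M ?_ k).symm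
      have := Finset.le_sup (f := N') (Finset.mem_univ j)
      omega)
  exact ⟨fun i => key (Sum.inl i) r (by omega), fun j => key (Sum.inr j) r (by omega)⟩

/-- A nonzero subspace stable under the coefficient operators contains a nonzero vector of the
form `(⨂ x) ⊗ (⨂ y) ⊗ v`. -/
theorem exists_tprod_mem (hs : ∀ i, IsExpModule (s i) (a i) (D i) (x i))
    (ht : ∀ j, IsExpModule (t j) (b j) (D' j) (y j))
    (W : Submodule ℂ (((⨂[ℂ] i, s i) ⊗[ℂ] (⨂[ℂ] j, t j)) ⊗[ℂ] V)) (hW : W ≠ ⊥)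
    (hl : ∀ i, ∀ c ∈ Algebra.adjoin ℂ (Set.range (D i)), ∀ w ∈ W,
      leftHom s t V (factorHom i c) w ∈ W)
    (hm : ∀ j, ∀ c ∈ Algebra.adjoin ℂ (Set.range (D' j)), ∀ w ∈ W,
      middleHom s t V (factorHom j c) w ∈ W) :
    ∃ v : V, v ≠ 0 ∧ (tprod ℂ x ⊗ₜ tprod ℂ y) ⊗ₜ v ∈ W := by
  choose ε hε hεx using fun i => exists_projection (x i)
  choose η hη hηy using fun j => exists_projection (y j)
  let A (i : ι) := (Algebra.adjoin ℂ (Set.range (D i))).map ((leftHom s t V).comp (factorHom i))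
  let B (j : κ) :=
    (Algebra.adjoin ℂ (Set.range (D' j))).map ((middleHom s t V).comp (factorHom j))
  let C : ι ⊕ κ → Subalgebra ℂ
    (Module.End ℂ (((⨂[ℂ] i, s i) ⊗[ℂ] (⨂[ℂ] j, t j)) ⊗[ℂ] V)) := Sum.elim A B
  let π : ι ⊕ κ → Module.End ℂ (((⨂[ℂ] i, s i) ⊗[ℂ] (⨂[ℂ] j, t j)) ⊗[ℂ] V) :=
    Sum.elim (fun i => leftHom s t V (factorHom i (ε i)))
      (fun j => middleHom s t V (factorHom j (η j)))
  have hcomm : ∀ i j, i ≠ j → ∀ c ∈ C i, Commute c (π j) := by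
    rintro (i | i) (j | j) hij _ ⟨c, -, rfl⟩
    · exact (factorHom_commute (fun h => hij (congrArg _ h)) _ _).map (leftHom s t V)
    · exact leftHom_commute_middleHom s t V _ _
    · exact (leftHom_commute_middleHom s t V _ _).symm
    · exact (factorHom_commute (fun h => hij (congrArg _ h)) _ _).map (middleHom s t V)
  have hfix : ∀ i w, w ≠ 0 → ∃ c ∈ C i, c w ≠ 0 ∧ π i (c w) = c w := by
    rintro (i | j) w hw
    · obtain ⟨F, hF, hFw⟩ := ((locallySupported_factorHom (s := s) i).rTensor
        (⨂[ℂ] j, t j)).rTensor V w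
      obtain ⟨c, hc, h0, h1⟩ :=
        exists_apply_ne_zero_of_contractsTo _ (hs i).contracts (hε i) hw F hF hFw
      exact ⟨_, ⟨c, hc, rfl⟩, h0, h1⟩
    · obtain ⟨F, hF, hFw⟩ := ((locallySupported_factorHom (s := t) j).lTensor
        (⨂[ℂ] i, s i)).rTensor V w
      obtain ⟨c, hc, h0, h1⟩ :=
        exists_apply_ne_zero_of_contractsTo _ (ht j).contracts (hη j) hw F hF hFw
      exact ⟨_, ⟨c, hc, rfl⟩, h0, h1⟩
  have hst : ∀ i, ∀ c ∈ C i, ∀ w ∈ W, c w ∈ W := by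
    rintro (i | j) _ ⟨c, hc, rfl⟩ w hw
    · exact hl i c hc w hw
    · exact hm j c hc w hw
  obtain ⟨w, hwW, hw0, hw⟩ := exists_fixed_vector
    (Z := ((⨂[ℂ] i, s i) ⊗[ℂ] (⨂[ℂ] j, t j)) ⊗[ℂ] V) C π hcomm hfix W hW hst
  have h1 := map_eq_of_forall_factorHom (leftHom s t V) ε w fun i => hw (Sum.inl i)
  have h2 := map_eq_of_forall_factorHom (middleHom s t V) η w fun j => hw (Sum.inr j)
  -- The product of all the projections has image in `(⨂ x) ⊗ (⨂ y) ⊗ V`, and it fixes `w`.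
  have h3 : ∀ z : ((⨂[ℂ] i, s i) ⊗[ℂ] (⨂[ℂ] j, t j)) ⊗[ℂ] V, ∃ v : V,
      leftHom s t V (PiTensorProduct.map ε) (middleHom s t V (PiTensorProduct.map η) z) =
        (tprod ℂ x ⊗ₜ tprod ℂ y) ⊗ₜ v := by
    intro z
    induction z using TensorProduct.induction_on with
    | zero => exact ⟨0, by simp⟩
    | add z z' hz hz' =>
      obtain ⟨v, hv⟩ := hz
      obtain ⟨v', hv'⟩ := hz'
      exact ⟨v + v', by rw [map_add, map_add, hv, hv', TensorProduct.tmul_add]⟩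
    | tmul p v =>
      induction p using TensorProduct.induction_on with
      | zero => exact ⟨0, by simp⟩
      | add p p' hp hp' =>
        obtain ⟨v, hv⟩ := hp
        obtain ⟨v', hv'⟩ := hp'
        exact ⟨v + v', by rw [TensorProduct.add_tmul, map_add, map_add, hv, hv',
          TensorProduct.tmul_add]⟩
      | tmul p q =>
        obtain ⟨c, hc⟩ := Submodule.mem_span_singleton.mp (map_mem_span_tprod ε x hεx p)
        obtain ⟨c', hc'⟩ := Submodule.mem_span_singleton.mp (map_mem_span_tprod η y hηy q)
        refine ⟨(c * c') • v, ?_⟩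
        rw [middleHom_tmul, leftHom_tmul, ← hc, ← hc']
        simp only [TensorProduct.smul_tmul', TensorProduct.tmul_smul, smul_smul]
        rw [mul_comm c c']
  obtain ⟨v, hv⟩ := h3 w
  rw [h2, h1] at hv
  subst hv
  refine ⟨v, ?_, hwW⟩
  rintro rfl
  exact hw0 (TensorProduct.tmul_zero _ _)

/-- A nonzero submodule is stable under each factor's coefficient algebra. Contraction puts some `(⨂
x) ⊗ (⨂ y) ⊗ v₀` with `v₀ ≠ 0` in it, generation fills the `Ω` factors, and irreducibility of `V`
fills the last one. -/
theorem isIrreducible_tensor (ha : ∀ i, a i ≠ 0) (hb : ∀ j, b j ≠ 0)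
    (hinj : Function.Injective (Sum.elim a b))
    (hs : ∀ i, IsExpModule (s i) (a i) (D i) (x i))
    (ht : ∀ j, IsExpModule (t j) (b j) (D' j) (y j))
    (hirr : LieModule.IsIrreducible ℂ Vir V)
    (hV : ∀ v : V, ∃ R : ℕ, ∀ k : ℕ, R ≤ k → ⁅d k, v⁆ = 0) :
    LieModule.IsIrreducible ℂ Vir (((⨂[ℂ] i, s i) ⊗[ℂ] (⨂[ℂ] j, t j)) ⊗[ℂ] V) := by
  have := LieModule.nontrivial_of_isIrreducible ℂ Vir V
  have : Nontrivial (⨂[ℂ] i, s i) := ⟨_, _, tprod_ne_zero fun i => (hs i).ne_zero⟩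
  have : Nontrivial (⨂[ℂ] j, t j) := ⟨_, _, tprod_ne_zero fun j => (ht j).ne_zero⟩
  refine LieModule.IsIrreducible.mk fun W hW => ?_
  have hst := coeff_mem_of_lie_mem ha hb hinj (fun i => (hs i).expansion)
    (fun j => (ht j).expansion) hV (W : Submodule ℂ _) (fun z w hw => W.lie_mem hw)
  have hl : ∀ i, ∀ c ∈ Algebra.adjoin ℂ (Set.range (D i)), ∀ w ∈ (W : Submodule ℂ _),
      leftHom s t V (factorHom i c) w ∈ (W : Submodule ℂ _) := fun i c hc =>
    apply_mem_of_mem_adjoin ((leftHom s t V).comp (factorHom i)) (D i) _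
      (fun r w hw => (hst r w hw).1 i) hc
  have hm : ∀ j, ∀ c ∈ Algebra.adjoin ℂ (Set.range (D' j)), ∀ w ∈ (W : Submodule ℂ _),
      middleHom s t V (factorHom j c) w ∈ (W : Submodule ℂ _) := fun j c hc =>
    apply_mem_of_mem_adjoin ((middleHom s t V).comp (factorHom j)) (D' j) _
      (fun r w hw => (hst r w hw).2 j) hc
  obtain ⟨v₀, hv₀, hmem⟩ := exists_tprod_mem hs ht W.toSubmodule
    (fun h => hW ((LieSubmodule.toSubmodule_eq_bot W).mp h)) hl hm
  have hall : ∀ v : V, (tprod ℂ x ⊗ₜ[ℂ] tprod ℂ y) ⊗ₜ[ℂ] v ∈ W.toSubmodule →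
      ∀ p : (⨂[ℂ] i, s i) ⊗[ℂ] (⨂[ℂ] j, t j), p ⊗ₜ[ℂ] v ∈ W.toSubmodule := by
    intro v hv p
    let σ : (⨂[ℂ] i, s i) ⊗[ℂ] (⨂[ℂ] j, t j) →ₗ[ℂ]
        ((⨂[ℂ] i, s i) ⊗[ℂ] (⨂[ℂ] j, t j)) ⊗[ℂ] V := (TensorProduct.mk ℂ _ V).flip v
    have h1 : ∀ q : ⨂[ℂ] i, s i, (q ⊗ₜ[ℂ] tprod ℂ y) ⊗ₜ[ℂ] v ∈ W.toSubmodule :=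
      tprod_mem_of_generates
        (Z := ((⨂[ℂ] i, s i) ⊗[ℂ] (⨂[ℂ] j, t j)) ⊗[ℂ] V)
        (σ ∘ₗ ((TensorProduct.mk ℂ _ _).flip (tprod ℂ y))) _ _ x
        (fun i => (hs i).generates) (fun i c hc w hw => hl i c hc _ hw) hv
    induction p using TensorProduct.induction_on with
    | zero => rw [TensorProduct.zero_tmul]; exact Submodule.zero_mem _
    | add p q hp hq => rw [TensorProduct.add_tmul]; exact Submodule.add_mem _ hp hq
    | tmul p q =>
      exact tprod_mem_of_generates
        (Z := ((⨂[ℂ] i, s i) ⊗[ℂ] (⨂[ℂ] j, t j)) ⊗[ℂ] V)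
        (σ ∘ₗ TensorProduct.mk ℂ _ _ p) _ _ y
        (fun j => (ht j).generates) (fun j c hc w hw => hm j c hc _ hw) (h1 p) q
  let U : LieSubmodule ℂ Vir V :=
    { carrier := {v | ∀ p : (⨂[ℂ] i, s i) ⊗[ℂ] (⨂[ℂ] j, t j), p ⊗ₜ[ℂ] v ∈ W}
      add_mem' := fun {v v'} hv hv' p => by
        rw [TensorProduct.tmul_add]
        exact W.add_mem (hv p) (hv' p)
      zero_mem' := fun p => by rw [TensorProduct.tmul_zero]; exact W.zero_mem
      smul_mem' := fun c v hv p => by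
        rw [TensorProduct.tmul_smul]
        exact W.smul_mem c (hv p)
      lie_mem := fun {z v} hv p => by
        -- Membership in `U` is required for every `p`, so it also covers the correction term with
        -- `⁅z, p⁆`.
        have h1 : p ⊗ₜ[ℂ] ⁅z, v⁆ = ⁅z, p ⊗ₜ[ℂ] v⁆ - ⁅z, p⁆ ⊗ₜ[ℂ] v := by
          rw [TensorProduct.LieModule.lie_tmul_right]
          exact (add_sub_cancel_left
            (G := ((⨂[ℂ] i, s i) ⊗[ℂ] (⨂[ℂ] j, t j)) ⊗[ℂ] V) _ _).symm
        rw [h1]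
        exact sub_mem (W.lie_mem (hv p)) (hv ⁅z, p⁆) }
  have hU : U = ⊤ := by
    refine (IsSimpleOrder.eq_bot_or_eq_top U).resolve_left fun h => hv₀ ?_
    have h1 : v₀ ∈ U := hall v₀ hmem
    rwa [h, LieSubmodule.mem_bot] at h1
  suffices H : ∀ w, w ∈ W from eq_top_iff.mpr fun w _ => H w
  intro w
  induction w using TensorProduct.induction_on with
  | zero => exact W.zero_mem
  | add w w' hw hw' => exact W.add_mem hw hw'
  | tmul p v =>
    have h1 : v ∈ U := by rw [hU]; exact LieSubmodule.mem_top _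
    exact h1 p

end Main

theorem omegaOne_isExpModule (mu : ℂˣ) (β : ℂ) (hβ : β ≠ 0) :
    IsExpModule (OmegaOne mu β) mu (omegaOneCoeff β) (1 : ℂ[X]) where
  expansion := omegaOne_hasExpansion mu β
  contracts := omegaOne_contractsTo β hβ
  generates := omegaOne_generates β
  ne_zero := one_ne_zero (α := ℂ[X])

theorem omegaTwo_isExpModule (lam : ℂˣ) (α : ℂ) (hα : α ≠ 0) (h : ℂ[X]) (hdeg : h.degree = 1) :
    IsExpModule (OmegaTwo lam α h) lam (omegaTwoCoeff α h) (1 : ℂ[X][X]) where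
  expansion := omegaTwo_hasExpansion lam α h
  contracts := omegaTwo_contractsTo α hα h hdeg
  generates := omegaTwo_generates α h hdeg
  ne_zero := one_ne_zero (α := ℂ[X][X])

end Vir

theorem theorem3p3 (m n : ℕ) (hm : 0 < m) (hn : 0 < n)
    (lam : Fin m → ℂˣ) (α : Fin m → ℂ) (h : Fin m → ℂ[X])
    (mu : Fin n → ℂˣ) (β : Fin n → ℂ)
    (hα : ∀ i, α i ≠ 0) (hdeg : ∀ i, (h i).degree = 1) (hβ : ∀ j, β j ≠ 0)
    (hdistinct : Function.Injective (Sum.elim lam mu))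
    (V : Type*) [AddCommGroup V] [Module ℂ V] [LieRingModule Vir V] [LieModule ℂ Vir V]
    (hV : LieModule.IsIrreducible ℂ Vir V)
    (K : ℕ) (hK : 0 < K)
    (hlf : ∀ k : ℤ, (K : ℤ) ≤ k → ActsLocallyFinitely (Vir.d k) V) :
    LieModule.IsIrreducible ℂ Vir
      (((⨂[ℂ] i : Fin m, Vir.OmegaTwo (lam i) (α i) (h i)) ⊗[ℂ]
        (⨂[ℂ] j : Fin n, Vir.OmegaOne (mu j) (β j))) ⊗[ℂ] V) := by
  refine Vir.isIrreducible_tensor (a := fun i => (lam i : ℂ)) (b := fun j => (mu j : ℂ))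
    (fun i => (lam i).ne_zero) (fun j => (mu j).ne_zero) ?_
    (fun i => Vir.omegaTwo_isExpModule (lam i) (α i) (hα i) (h i) (hdeg i))
    (fun j => Vir.omegaOne_isExpModule (mu j) (β j) (hβ j)) hV
    (Vir.forall_exists_d_eq_zero hV K hK (hlf K le_rfl))
  have e : Sum.elim (fun i => (lam i : ℂ)) (fun j => (mu j : ℂ)) =
      (fun u : ℂˣ => (u : ℂ)) ∘ Sum.elim lam mu := by
    funext z
    rcases z with i | j <;> rfl
  rw [e]
  exact Units.val_injective.comp hdistinct
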